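/- Let $\beta\ge 0$. Real random variables $(\xi_i)_{i\in I}$ indexed by a finite set $I$ with $|I|=M\ge 1$ are called Curie–Weiss random variables with inverse temperature $\beta$ if they take values in $\{-1,1\}$ and, for every $x\in\{-1,1\}^I$, $$\mathbb P(\xi_i=x_i\text{ for all }i\in I)=Z^{-1}\exp\Big(\frac{\beta}{2M}\Big(\sum_{i\in I}x_i\Big)^2\Big),$$ where $Z=Z_{\beta,M}$ is the normalization constant. On a probability space $(\Omega,\mathcal F,\mathbb P)$ let, for every $N\in\mathbb N$, $(\tilde X_N(i,j))_{1\le i,j\le N}$ be $N^2$ Curie–Weiss random variables with inverse temperature $\beta$ (with an arbitrary joint distribution for different $N$), and let $X_N$ be the real symmetric $N\times N$ matrix with $X_N(i,j)=\tilde X_N(i,j)$ for $i\le j$ and $X_N(i,j)=\tilde X_N(j,i)$ for $i>j$ (the full Curie–Weiss ensemble). Let $\|\cdot\|$ denote the operator norm on the Euclidean space $\mathbb R^N$. Then: (i) If $\beta<1$, then $\mathbb P$-almost surely $\big\|\tfrac{1}{\sqrt N}X_N\big\|\to 2$ as $N\to\infty$. (ii) If $\beta=1$, then $\mathbb P$-almost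 surely, for every $\gamma>1/2$, $\big\|\tfrac{1}{N^{\gamma}}X_N\big\|\to 0$ as $N\to\infty$. (iii) If $\beta>1$, then the equation $\tanh(\beta m)=m$ has a unique strictly positive solution $m=m(\beta)$, and $\mathbb P$-almost surely $\big\|\tfrac1N X_N\big\|\to m(\beta)$ as $N\to\infty$. -/

import Mathlib

open MeasureTheory Filter Topology

noncomputable section

/-- The Boltzmann weight `exp ((β / (2 M)) (∑ i, x i)²)` of a spin configuration
`x ∈ {-1, 1}^ι`, where `M` is the number of elements of `ι`. -/
def curieWeissWeight {ι : Type*} [Fintype ι] (β : ℝ) (x : ι → ℤˣ) : ℝ :=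
  Real.exp (β / (2 * (Fintype.card ι : ℝ)) * (∑ i, ((x i : ℤ) : ℝ)) ^ 2)

/-- The normalization constant `Z`. -/
def curieWeissPartition (ι : Type*) [Fintype ι] [DecidableEq ι] (β : ℝ) : ℝ :=
  ∑ x : ι → ℤˣ, curieWeissWeight β x

/-- The real random variables `ξ i` are Curie-Weiss distributed with inverse temperature `β`:
the configuration `x ∈ {-1, 1}^ι` is attained with probability `Z⁻¹ exp (β / (2 M) (∑ x i)²)`.
(These probabilities add up to `1`, so they determine the joint law.) -/
structure IsCurieWeiss {Ω : Type*} [MeasurableSpace Ω] {ι : Type*} [Fintype ι] [DecidableEq ι]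
    (P : Measure Ω) (β : ℝ) (ξ : ι → Ω → ℝ) : Prop where
  measurable : ∀ i, Measurable (ξ i)
  prob_eq : ∀ x : ι → ℤˣ,
    P {ω | ∀ i, ξ i ω = ((x i : ℤ) : ℝ)} =
      ENNReal.ofReal ((curieWeissPartition ι β)⁻¹ * curieWeissWeight β x)

/-- `X N`, `N ∈ ℕ`, is a full Curie-Weiss ensemble on `(Ω, P)`: the symmetric `N × N` matrix `X N`
has the upper triangular part of an array of `N²` Curie-Weiss variables. Nothing is assumed
about the joint law of the matrices for different `N`. -/
def IsFullCurieWeissEnsemble {Ω : Type*} [MeasurableSpace Ω] (P : Measure Ω) (β : ℝ)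
    (X : (N : ℕ) → Ω → Matrix (Fin N) (Fin N) ℝ) : Prop :=
  ∀ N : ℕ, ∃ Y : Fin N × Fin N → Ω → ℝ, IsCurieWeiss P β Y ∧
    ∀ ω i j, X N ω i j = if i ≤ j then Y (i, j) ω else Y (j, i) ω

/-- The norm of a matrix as an operator on the Euclidean space `ℝ^N`. -/
def euclideanOpNorm {N : ℕ} (A : Matrix (Fin N) (Fin N) ℝ) : ℝ :=
  ‖Matrix.toEuclideanCLM (n := Fin N) (𝕜 := ℝ) A‖

/-- `m` is a strictly positive solution of `tanh (β m) = m`. -/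
def IsCurieWeissMagnetization (β m : ℝ) : Prop :=
  0 < m ∧ Real.tanh (β * m) = m

end

noncomputable section

/-! ### Averages of polynomials over random signs -/

section RademacherMean

lemma mvPolynomial_induction_pair {σ : Type*} {q : MvPolynomial σ ℕ → MvPolynomial σ ℕ → Prop}
    (hm : ∀ d c d' c', q (MvPolynomial.monomial d c) (MvPolynomial.monomial d' c'))
    (hl : ∀ p p' r, q p r → q p' r → q (p + p') r)
    (hr : ∀ p r r', q p r → q p r' → q p (r + r')) (p r : MvPolynomial σ ℕ) : q p r := by
  induction p using MvPolynomial.induction_on' with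
  | add p p' hp hp' => exact hl _ _ _ hp hp'
  | monomial d c =>
    induction r using MvPolynomial.induction_on' with
    | add r r' h h' => exact hr _ _ _ h h'
    | monomial d' c' => exact hm _ _ _ _

variable {σ : Type*} [Fintype σ] [DecidableEq σ]

/-- A sign configuration, viewed as a real vector. -/
def signVec (x : σ → ℤˣ) : σ → ℝ := fun i => ((x i : ℤ) : ℝ)

/-- The average over all sign configurations. -/
def signMean (f : (σ → ℤˣ) → ℝ) : ℝ := (∑ x, f x) / 2 ^ Fintype.card σ

/-- The expectation of a polynomial with natural coefficients in independent random signs. -/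
def radMean : MvPolynomial σ ℕ →+ ℝ where
  toFun p := signMean fun x => MvPolynomial.aeval (signVec x) p
  map_zero' := by simp [signMean]
  map_add' p q := by simp [signMean, Finset.sum_add_distrib, add_div]

lemma radMean_apply (p : MvPolynomial σ ℕ) :
    radMean p = signMean fun x => MvPolynomial.aeval (signVec x) p := rfl

lemma sum_units_int (f : ℤˣ → ℝ) : ∑ s : ℤˣ, f s = f 1 + f (-1) := by
  rw [show (Finset.univ : Finset ℤˣ) = {1, -1} by rfl, Finset.sum_pair (by decide)]

lemma sum_prod_units (f : σ → ℤˣ → ℝ) :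
    ∑ x : σ → ℤˣ, ∏ i, f i (x i) = ∏ i, (f i 1 + f i (-1)) := by
  simp_rw [← sum_units_int]
  rw [Finset.prod_univ_sum, Fintype.piFinset_univ]

lemma radMean_monomial (d : σ →₀ ℕ) (c : ℕ) :
    radMean (MvPolynomial.monomial d c) = c * if ∀ i, Even (d i) then 1 else 0 := by
  have h1 : ∀ x : σ → ℤˣ, MvPolynomial.aeval (signVec x) (MvPolynomial.monomial d c) =
      (c : ℝ) * ∏ i, ((x i : ℤ) : ℝ) ^ d i := by
    intro x
    rw [MvPolynomial.aeval_monomial, Finsupp.prod_fintype _ _ (by simp)]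
    simp [signVec]
  have h2 : ∑ x : σ → ℤˣ, ∏ i, ((x i : ℤ) : ℝ) ^ d i
      = 2 ^ Fintype.card σ * if ∀ i, Even (d i) then 1 else 0 := by
    rw [sum_prod_units (fun i s => ((s : ℤ) : ℝ) ^ d i)]
    split_ifs with h
    · have : ∀ i, (((1 : ℤˣ) : ℤ) : ℝ) ^ d i + (((-1 : ℤˣ) : ℤ) : ℝ) ^ d i = 2 := by
        intro i
        simp [(h i).neg_one_pow]
        norm_num
      rw [Finset.prod_congr rfl fun i _ => this i]
      simp
    · push Not at h
      obtain ⟨i, hi⟩ := h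
      rw [mul_zero]
      refine Finset.prod_eq_zero (Finset.mem_univ i) ?_
      simp [(Nat.not_even_iff_odd.1 hi).neg_one_pow]
  rw [radMean_apply, signMean]
  simp_rw [h1]
  rw [← Finset.mul_sum, h2]
  field_simp

lemma radMean_nonneg (p : MvPolynomial σ ℕ) : 0 ≤ radMean p := by
  induction p using MvPolynomial.induction_on' with
  | monomial d c => rw [radMean_monomial]; positivity
  | add p q hp hq => rw [map_add]; positivity

lemma radMean_one : radMean (1 : MvPolynomial σ ℕ) = 1 := by
  have := radMean_monomial (0 : σ →₀ ℕ) 1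
  simpa using this

lemma radMean_X_mul_le (e : σ) (p : MvPolynomial σ ℕ) :
    radMean (MvPolynomial.X e * p) ≤ radMean (MvPolynomial.pderiv e p) := by
  induction p using MvPolynomial.induction_on' with
  | add p q hp hq => rw [mul_add, map_add, map_add, map_add]; exact add_le_add hp hq
  | monomial d c =>
    rw [MvPolynomial.pderiv_monomial, MvPolynomial.X, MvPolynomial.monomial_mul, radMean_monomial,
      radMean_monomial, one_mul]
    by_cases h : ∀ i, Even ((Finsupp.single e 1 + d : σ →₀ ℕ) i)
    · have hpos : 1 ≤ d e := by
        have := h e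
        simp only [Finsupp.add_apply, Finsupp.single_eq_same] at this
        by_contra h0
        simp [show d e = 0 by omega] at this
      have h' : ∀ i, Even ((d - Finsupp.single e 1 : σ →₀ ℕ) i) := by
        intro i
        have := h i
        by_cases hi : i = e
        · subst hi
          simp only [Finsupp.add_apply, Finsupp.single_eq_same, Finsupp.tsub_apply] at this ⊢
          grind
        · simpa [Finsupp.single_apply, Ne.symm hi] using this
      rw [if_pos h, if_pos h', mul_one, mul_one]
      exact_mod_cast Nat.le_mul_of_pos_right _ hpos
    · rw [if_neg h]
      simp only [mul_zero]
      positivity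

lemma radMean_mul_radMean_le (p q : MvPolynomial σ ℕ) :
    radMean p * radMean q ≤ radMean (p * q) := by
  refine mvPolynomial_induction_pair (q := fun p q => radMean p * radMean q ≤ radMean (p * q))
    ?_ ?_ ?_ p q
  · intro d c d' c'
    rw [MvPolynomial.monomial_mul, radMean_monomial, radMean_monomial, radMean_monomial]
    by_cases h : ∀ i, Even (d i)
    · by_cases h' : ∀ i, Even (d' i)
      · have : ∀ i, Even ((d + d') i) := fun i => (h i).add (h' i)
        rw [if_pos h, if_pos h', if_pos this]
        push_cast
        linarith
      · rw [if_neg h']; simp only [mul_zero]; positivity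
    · rw [if_neg h]; simp only [mul_zero, zero_mul]; positivity
  · intro p p' r h h'
    rw [add_mul, map_add, map_add, add_mul]; exact add_le_add h h'
  · intro p r r' h h'
    rw [mul_add, map_add, map_add, mul_add]; exact add_le_add h h'

lemma radMean_mul_le (p q : MvPolynomial σ ℕ) :
    radMean (p * q) ≤ radMean p * radMean q +
      ∑ e, radMean (MvPolynomial.pderiv e p * MvPolynomial.pderiv e q) := by
  refine mvPolynomial_induction_pair (q := fun p q => radMean (p * q) ≤ radMean p * radMean q +
      ∑ e, radMean (MvPolynomial.pderiv e p * MvPolynomial.pderiv e q)) ?_ ?_ ?_ p q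
  · intro d c d' c'
    have hs : 0 ≤ ∑ e, radMean (MvPolynomial.pderiv e (MvPolynomial.monomial d c) *
        MvPolynomial.pderiv e (MvPolynomial.monomial d' c')) :=
      Finset.sum_nonneg fun e _ => radMean_nonneg _
    rw [MvPolynomial.monomial_mul]
    by_cases hdd : ∀ i, Even ((d + d') i)
    · by_cases h : ∀ i, Even (d i)
      · have h' : ∀ i, Even (d' i) := by
          intro i
          have := hdd i
          rw [Finsupp.add_apply, Nat.even_add] at this
          exact this.1 (h i)
        refine le_add_of_le_of_nonneg ?_ hs
        rw [radMean_monomial, radMean_monomial, radMean_monomial, if_pos h, if_pos h', if_pos hdd]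
        push_cast
        linarith
      · refine le_add_of_nonneg_of_le (mul_nonneg (radMean_nonneg _) (radMean_nonneg _)) ?_
        push Not at h
        obtain ⟨e, he⟩ := h
        have h1 : Odd (d e) := Nat.not_even_iff_odd.1 he
        have h2 : Odd (d' e) := by
          have := hdd e
          rw [Finsupp.add_apply, Nat.even_add] at this
          exact Nat.not_even_iff_odd.1 fun h => he (this.2 h)
        refine le_trans ?_ (Finset.single_le_sum (fun e _ => radMean_nonneg
          (MvPolynomial.pderiv e (MvPolynomial.monomial d c) *
          MvPolynomial.pderiv e (MvPolynomial.monomial d' c'))) (Finset.mem_univ e))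
        rw [MvPolynomial.pderiv_monomial, MvPolynomial.pderiv_monomial, MvPolynomial.monomial_mul,
          radMean_monomial, radMean_monomial, if_pos hdd, if_pos, mul_one, mul_one]
        · have : c * c' ≤ c * d e * (c' * d' e) :=
            Nat.mul_le_mul (Nat.le_mul_of_pos_right _ h1.pos) (Nat.le_mul_of_pos_right _ h2.pos)
          exact_mod_cast this
        · intro i
          have := hdd i
          by_cases hi : i = e
          · subst hi
            simp only [Finsupp.add_apply, Finsupp.single_eq_same, Finsupp.tsub_apply] at this ⊢
            exact (Nat.Odd.sub_odd h1 odd_one).add (Nat.Odd.sub_odd h2 odd_one)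
          · simpa [Finsupp.single_apply, Ne.symm hi] using this
    · rw [radMean_monomial, if_neg hdd, mul_zero]
      exact add_nonneg (mul_nonneg (radMean_nonneg _) (radMean_nonneg _)) hs
  · intro p p' r h h'
    simp only [add_mul, map_add, Finset.sum_add_distrib]
    linarith
  · intro p r r' h h'
    simp only [mul_add, map_add, Finset.sum_add_distrib]
    linarith

end RademacherMean


/-! ### Symmetric matrices built from an array, and their trace moments -/

section TraceMoments

variable {N : ℕ}

/-- The position in the upper triangle of the entry `(i, j)` of a symmetric matrix. -/
def symmKey (i j : Fin N) : Fin N × Fin N := if i ≤ j then (i, j) else (j, i)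

/-- The symmetric matrix with the upper triangular part of a given array. -/
def symmMatrix {R : Type*} (y : Fin N × Fin N → R) : Matrix (Fin N) (Fin N) R :=
  Matrix.of fun i j => y (symmKey i j)

lemma symmKey_comm (i j : Fin N) : symmKey i j = symmKey j i := by
  unfold symmKey
  rcases lt_trichotomy i j with h | h | h
  · simp [h.le, h.not_ge]
  · simp [h]
  · simp [h.le, h.not_ge]

lemma eq_or_eq_of_symmKey_eq {i j k l : Fin N} (h : symmKey i j = symmKey k l) :
    (k = i ∧ l = j) ∨ (k = j ∧ l = i) := by
  unfold symmKey at h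
  split_ifs at h <;> simp only [Prod.mk.injEq] at h <;> tauto

lemma symmMatrix_apply {R : Type*} (y : Fin N × Fin N → R) (i j : Fin N) :
    symmMatrix y i j = y (symmKey i j) := rfl

lemma symmMatrix_transpose {R : Type*} (y : Fin N × Fin N → R) :
    (symmMatrix y).transpose = symmMatrix y := by
  ext i j
  rw [Matrix.transpose_apply, symmMatrix_apply, symmMatrix_apply, symmKey_comm]

lemma symmMatrix_pow_transpose {R : Type*} [CommSemiring R] (y : Fin N × Fin N → R) (n : ℕ) :
    (symmMatrix y ^ n).transpose = symmMatrix y ^ n := by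
  rw [Matrix.transpose_pow, symmMatrix_transpose]

/-- The symmetric matrix of indeterminates. -/
def polyMatrix (N : ℕ) : Matrix (Fin N) (Fin N) (MvPolynomial (Fin N × Fin N) ℕ) :=
  symmMatrix MvPolynomial.X

lemma polyMatrix_pow_symm (n : ℕ) (i j : Fin N) :
    (polyMatrix N ^ n) i j = (polyMatrix N ^ n) j i := by
  conv_rhs => rw [← Matrix.transpose_apply (polyMatrix N ^ n), polyMatrix,
    symmMatrix_pow_transpose]
  rfl

lemma aeval_polyMatrix_pow (y : Fin N × Fin N → ℝ) (n : ℕ) (i j : Fin N) :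
    MvPolynomial.aeval y ((polyMatrix N ^ n) i j) = (symmMatrix y ^ n) i j := by
  have h : (polyMatrix N).map (MvPolynomial.aeval y) = symmMatrix y := by
    ext i j
    simp [polyMatrix, symmMatrix_apply]
  rw [← h, show ((polyMatrix N).map (MvPolynomial.aeval y)) ^ n =
    (polyMatrix N ^ n).map (MvPolynomial.aeval y) from
    (map_pow (MvPolynomial.aeval y : MvPolynomial (Fin N × Fin N) ℕ →ₐ[ℕ] ℝ).mapMatrix _ n).symm,
    Matrix.map_apply]

lemma aeval_trace_polyMatrix_pow (y : Fin N × Fin N → ℝ) (n : ℕ) :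
    MvPolynomial.aeval y (polyMatrix N ^ n).trace = (symmMatrix y ^ n).trace := by
  simp [Matrix.trace, aeval_polyMatrix_pow]

/-- The expected trace of the `n`-th power of a symmetric matrix of random signs. -/
def traceMoment (N n : ℕ) : ℝ := radMean (polyMatrix N ^ n).trace

lemma traceMoment_eq (N n : ℕ) :
    traceMoment N n = signMean fun x : Fin N × Fin N → ℤˣ => (symmMatrix (signVec x) ^ n).trace := by
  simp_rw [traceMoment, radMean_apply, aeval_trace_polyMatrix_pow]

lemma traceMoment_nonneg (N n : ℕ) : 0 ≤ traceMoment N n := radMean_nonneg _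

lemma traceMoment_zero (N : ℕ) : traceMoment N 0 = N := by
  have : ((N : ℕ) : MvPolynomial (Fin N × Fin N) ℕ) = N • 1 := by simp
  rw [traceMoment, pow_zero, Matrix.trace_one, Fintype.card_fin, this, map_nsmul, radMean_one]
  simp

lemma traceMoment_odd (N : ℕ) {n : ℕ} (hn : Odd n) : traceMoment N n = 0 := by
  have h : ∑ x : Fin N × Fin N → ℤˣ, (symmMatrix (signVec x) ^ n).trace =
      ∑ x : Fin N × Fin N → ℤˣ, (symmMatrix (signVec (-x)) ^ n).trace :=
    (Equiv.sum_comp (Equiv.neg _) fun x => (symmMatrix (signVec x) ^ n).trace).symm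
  have h' : ∀ x : Fin N × Fin N → ℤˣ, symmMatrix (signVec (-x)) = -symmMatrix (signVec x) := by
    intro x
    ext i j
    simp [symmMatrix_apply, signVec]
  simp_rw [h', hn.neg_pow, Matrix.trace_neg, Finset.sum_neg_distrib] at h
  rw [traceMoment_eq, signMean, show ∑ x : Fin N × Fin N → ℤˣ, (symmMatrix (signVec x) ^ n).trace = 0
    by linarith, zero_div]

section Leibniz

variable {R A n : Type*} [CommSemiring R] [CommSemiring A] [Algebra R A] [Fintype n]

lemma derivation_matrix_mul (D : Derivation R A A) (P Q : Matrix n n A) :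
    (P * Q).map D = P.map D * Q + P * Q.map D := by
  ext i j
  simp only [Matrix.map_apply, Matrix.mul_apply, Matrix.add_apply, map_sum, Derivation.leibniz,
    smul_eq_mul, Finset.sum_add_distrib]
  rw [add_comm]
  congr 1
  exact Finset.sum_congr rfl fun k _ => mul_comm _ _

lemma derivation_matrix_pow [DecidableEq n] (D : Derivation R A A) (P : Matrix n n A) (k : ℕ) :
    (P ^ (k + 1)).map D = ∑ ab ∈ Finset.HasAntidiagonal.antidiagonal k, P ^ ab.1 * P.map D * P ^ ab.2 := by
  induction k with
  | zero => simp
  | succ k ih =>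
    rw [pow_succ', derivation_matrix_mul, ih, Finset.Nat.antidiagonal_succ, Finset.sum_cons,
      Finset.sum_map, Finset.mul_sum]
    simp [pow_succ', mul_assoc]

lemma derivation_trace_pow [DecidableEq n] (D : Derivation R A A) (P : Matrix n n A) (k : ℕ) :
    D (P ^ (k + 1)).trace = (k + 1) • (P.map D * P ^ k).trace := by
  have h : D (P ^ (k + 1)).trace = ((P ^ (k + 1)).map D).trace := by
    simp [Matrix.trace]
  rw [h, derivation_matrix_pow, Matrix.trace_sum]
  rw [Finset.sum_congr rfl (g := fun _ => (P.map D * P ^ k).trace)]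
  · simp
  · rintro ⟨a, b⟩ hab
    rw [Matrix.mul_assoc, Matrix.trace_mul_comm, Matrix.mul_assoc, ← pow_add,
      add_comm, Finset.HasAntidiagonal.mem_antidiagonal.1 hab]

end Leibniz

lemma pderiv_polyMatrix_apply (e : Fin N × Fin N) (k l : Fin N) :
    (polyMatrix N).map (MvPolynomial.pderiv e) k l = if symmKey k l = e then 1 else 0 := by
  rw [Matrix.map_apply, polyMatrix, symmMatrix_apply, MvPolynomial.pderiv_X, Pi.single_apply]

lemma radMean_sum_symmKey_le (i j : Fin N)
    (f : Fin N → Fin N → MvPolynomial (Fin N × Fin N) ℕ) :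
    radMean (∑ k, ∑ l, if symmKey k l = symmKey i j then f k l else 0) ≤
      radMean (f i j) + radMean (f j i) := by
  have h : ∀ k l, radMean (if symmKey k l = symmKey i j then f k l else 0) ≤
      (if k = i then if l = j then radMean (f i j) else 0 else 0) +
      (if k = j then if l = i then radMean (f j i) else 0 else 0) := by
    intro k l
    have h1 := radMean_nonneg (f i j)
    have h2 := radMean_nonneg (f j i)
    by_cases hk : symmKey k l = symmKey i j
    · rw [if_pos hk]
      rcases eq_or_eq_of_symmKey_eq hk.symm with ⟨rfl, rfl⟩ | ⟨rfl, rfl⟩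
      · simp only [if_true]
        refine le_add_of_nonneg_right ?_
        split_ifs <;> simp [h2]
      · simp only [if_true]
        refine le_add_of_nonneg_left ?_
        split_ifs <;> simp [h1]
    · rw [if_neg hk, map_zero]
      refine add_nonneg ?_ ?_ <;> split_ifs <;> simp [h1, h2]
  simp_rw [map_sum]
  refine (Finset.sum_le_sum fun k _ => Finset.sum_le_sum fun l _ => h k l).trans ?_
  simp [Finset.sum_add_distrib, Finset.sum_ite_eq']

end TraceMoments

section MomentRecursion

open Finset.HasAntidiagonal

variable {N : ℕ}

lemma sum_radMean_polyMatrix_pow_mul (a b : ℕ) :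
    ∑ i, ∑ j, radMean ((polyMatrix N ^ a) i j * (polyMatrix N ^ b) i j) = traceMoment N (a + b) := by
  simp_rw [traceMoment, pow_add, Matrix.trace, Matrix.diag, Matrix.mul_apply, map_sum]
  exact Finset.sum_congr rfl fun i _ => Finset.sum_congr rfl fun j _ => by
    rw [polyMatrix_pow_symm b i j]

lemma sum_radMean_pderiv_trace_le (a b : ℕ) :
    ∑ e, radMean (MvPolynomial.pderiv e (polyMatrix N ^ (a + 1)).trace *
      MvPolynomial.pderiv e (polyMatrix N ^ (b + 1)).trace) ≤
      2 * (a + 1) * (b + 1) * traceMoment N (a + b) := by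
  have htr : ∀ (e : Fin N × Fin N) (c : ℕ),
      ((polyMatrix N).map (MvPolynomial.pderiv e) * polyMatrix N ^ c).trace =
      ∑ k, ∑ l, if symmKey k l = e then (polyMatrix N ^ c) k l else 0 := by
    intro e c
    simp_rw [Matrix.trace, Matrix.diag, Matrix.mul_apply, pderiv_polyMatrix_apply, ite_mul, one_mul,
      zero_mul, polyMatrix_pow_symm c]
  have hswap : ∀ v : Fin N × Fin N → MvPolynomial (Fin N × Fin N) ℕ,
      ∑ e, (∑ k, ∑ l, if symmKey k l = e then (polyMatrix N ^ a) k l else 0) * v e =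
      ∑ k, ∑ l, (polyMatrix N ^ a) k l * v (symmKey k l) := by
    intro v
    simp_rw [Finset.sum_mul]
    rw [Finset.sum_comm]
    refine Finset.sum_congr rfl fun k _ => ?_
    rw [Finset.sum_comm]
    refine Finset.sum_congr rfl fun l _ => ?_
    simp [ite_mul]
  have hsum : ∑ e, radMean (((polyMatrix N).map (MvPolynomial.pderiv e) * polyMatrix N ^ a).trace *
      ((polyMatrix N).map (MvPolynomial.pderiv e) * polyMatrix N ^ b).trace) ≤
      2 * traceMoment N (a + b) := by
    rw [← map_sum]
    simp_rw [htr]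
    rw [hswap, map_sum]
    simp_rw [map_sum, Finset.mul_sum]
    rw [two_mul]
    conv_rhs => rw [← sum_radMean_polyMatrix_pow_mul, ← Finset.sum_add_distrib]
    refine Finset.sum_le_sum fun i _ => ?_
    rw [← Finset.sum_add_distrib]
    refine Finset.sum_le_sum fun j _ => ?_
    simp_rw [mul_ite, mul_zero]
    refine (radMean_sum_symmKey_le i j fun k l =>
      (polyMatrix N ^ a) i j * (polyMatrix N ^ b) k l).trans ?_
    rw [polyMatrix_pow_symm b j i]
  calc _ = ((a + 1 : ℕ) : ℝ) * ((b + 1 : ℕ) : ℝ) *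
      ∑ e, radMean (((polyMatrix N).map (MvPolynomial.pderiv e) * polyMatrix N ^ a).trace *
      ((polyMatrix N).map (MvPolynomial.pderiv e) * polyMatrix N ^ b).trace) := by
        rw [Finset.mul_sum]
        refine Finset.sum_congr rfl fun e _ => ?_
        rw [derivation_trace_pow, derivation_trace_pow, smul_mul_smul_comm, map_nsmul,
          nsmul_eq_mul, Nat.cast_mul]
    _ ≤ _ := by
        push_cast
        have := mul_le_mul_of_nonneg_left hsum (by positivity : (0 : ℝ) ≤ (a + 1) * (b + 1))
        linarith

lemma radMean_trace_mul_trace_le {n : ℕ} (a b : ℕ) (hab : a + b = n + 2) :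
    radMean ((polyMatrix N ^ a).trace * (polyMatrix N ^ b).trace) ≤
      traceMoment N a * traceMoment N b + 2 * a * b * traceMoment N n := by
  refine (radMean_mul_le _ _).trans (add_le_add_right ?_ _)
  rcases a with _ | a
  · simp [Matrix.trace_one]
  rcases b with _ | b
  · simp [Matrix.trace_one]
  obtain rfl : n = a + b := by omega
  exact_mod_cast sum_radMean_pderiv_trace_le a b

lemma traceMoment_add_two_le (n : ℕ) :
    traceMoment N (n + 2) ≤ ∑ ab ∈ antidiagonal n,
      (traceMoment N n + radMean ((polyMatrix N ^ ab.1).trace * (polyMatrix N ^ ab.2).trace)) := by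
  have h1 : traceMoment N (n + 2) =
      ∑ i, ∑ j, radMean (MvPolynomial.X (symmKey i j) * (polyMatrix N ^ (n + 1)) j i) := by
    rw [traceMoment, pow_succ']
    simp_rw [Matrix.trace, Matrix.diag, Matrix.mul_apply, map_sum]
    rfl
  have h2 : ∀ i j, radMean (MvPolynomial.X (symmKey i j) * (polyMatrix N ^ (n + 1)) j i) ≤
      ∑ ab ∈ antidiagonal n, (radMean ((polyMatrix N ^ ab.1) j i * (polyMatrix N ^ ab.2) j i) +
        radMean ((polyMatrix N ^ ab.1) j j * (polyMatrix N ^ ab.2) i i)) := by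
    intro i j
    refine (radMean_X_mul_le _ _).trans ?_
    have : MvPolynomial.pderiv (symmKey i j) ((polyMatrix N ^ (n + 1)) j i) =
        ((polyMatrix N ^ (n + 1)).map (MvPolynomial.pderiv (symmKey i j))) j i := rfl
    rw [this, derivation_matrix_pow, Matrix.sum_apply, map_sum]
    refine Finset.sum_le_sum fun ab _ => ?_
    have h3 : (polyMatrix N ^ ab.1 * (polyMatrix N).map (MvPolynomial.pderiv (symmKey i j)) *
        polyMatrix N ^ ab.2) j i = ∑ k, ∑ l, if symmKey k l = symmKey i j then
          (polyMatrix N ^ ab.1) j k * (polyMatrix N ^ ab.2) l i else 0 := by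
      simp_rw [Matrix.mul_apply, pderiv_polyMatrix_apply, Finset.sum_mul]
      rw [Finset.sum_comm]
      refine Finset.sum_congr rfl fun k _ => Finset.sum_congr rfl fun l _ => ?_
      split_ifs <;> simp
    rw [h3]
    exact radMean_sum_symmKey_le i j fun k l => (polyMatrix N ^ ab.1) j k * (polyMatrix N ^ ab.2) l i
  rw [h1]
  refine (Finset.sum_le_sum fun i _ => Finset.sum_le_sum fun j _ => h2 i j).trans (le_of_eq ?_)
  simp_rw [Finset.sum_comm (t := antidiagonal n)]
  refine Finset.sum_congr rfl fun ab hab => ?_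
  simp_rw [Finset.sum_add_distrib]
  congr 1
  · rw [Finset.sum_comm, sum_radMean_polyMatrix_pow_mul, mem_antidiagonal.1 hab]
  · rw [Finset.sum_comm]
    simp_rw [Matrix.trace, Matrix.diag, Finset.sum_mul_sum, map_sum]

lemma sum_antidiagonal_even {f : ℕ → ℕ → ℝ} (hf : ∀ a b, Odd a → f a b = 0) (k : ℕ) :
    ∑ ab ∈ antidiagonal (2 * k), f ab.1 ab.2 = ∑ ab ∈ antidiagonal k, f (2 * ab.1) (2 * ab.2) := by
  symm
  refine Finset.sum_of_injOn (fun ab => (2 * ab.1, 2 * ab.2)) ?_ ?_ ?_ ?_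
  · rintro ⟨a, b⟩ _ ⟨c, d⟩ _ h
    simp only [Prod.mk.injEq] at h ⊢
    omega
  · rintro ⟨a, b⟩ h
    simp only [Finset.mem_coe, mem_antidiagonal] at h ⊢
    omega
  · rintro ⟨a, b⟩ h h'
    refine hf _ _ ?_
    by_contra ha
    rw [Nat.not_odd_iff_even] at ha
    obtain ⟨c, rfl⟩ := ha
    rw [mem_antidiagonal] at h
    refine h' ⟨(c, k - c), ?_, ?_⟩
    · simp only [Finset.mem_coe, mem_antidiagonal]; omega
    · simp only [Prod.mk.injEq]; omega
  · intros; rfl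

lemma catalan_le_succ (k : ℕ) : catalan k ≤ catalan (k + 1) := by
  rw [catalan_succ']
  refine le_trans ?_ (Finset.single_le_sum (f := fun ij : ℕ × ℕ => catalan ij.1 * catalan ij.2)
    (fun _ _ => Nat.zero_le _) (mem_antidiagonal.2 (zero_add k) : (0, k) ∈ antidiagonal k))
  simp

/-- Trace moments of order up to `2 K` are bounded by Catalan numbers, up to a factor. -/
theorem traceMoment_le_catalan (K : ℕ) (hN : 0 < N) (k : ℕ) (hk : k ≤ K) :
    traceMoment N (2 * k) ≤
      N ^ (k + 1) * (1 + (2 * K / N + 4 * K ^ 3 / N ^ 2 : ℝ)) ^ k * catalan k := by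
  have hN' : (0 : ℝ) < N := by exact_mod_cast hN
  set c : ℝ := 1 + (2 * K / N + 4 * K ^ 3 / N ^ 2 : ℝ) with hc
  have hc1 : 1 ≤ c := by rw [hc]; exact le_add_of_nonneg_right (by positivity)
  have hc0 : 0 < c := by linarith
  induction k using Nat.strong_induction_on with
  | _ k ih =>
  rcases k with _ | k
  · simp [traceMoment_zero]
  have hkK : (k + 1 : ℝ) ≤ K := by exact_mod_cast hk
  have hk0 : (0 : ℝ) ≤ k := by positivity
  have hT := ih k (by omega) (by omega)
  -- the product terms
  have hprod : ∑ ab ∈ antidiagonal (2 * k), traceMoment N ab.1 * traceMoment N ab.2 ≤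
      N ^ (k + 2) * c ^ k * catalan (k + 1) := by
    rw [sum_antidiagonal_even (f := fun a b => traceMoment N a * traceMoment N b)
      (fun a b ha => by simp [traceMoment_odd N ha]), catalan_succ']
    push_cast
    rw [Finset.mul_sum]
    refine Finset.sum_le_sum fun ab hab => ?_
    have hab' := mem_antidiagonal.1 hab
    refine (mul_le_mul (ih ab.1 (by omega) (by omega)) (ih ab.2 (by omega) (by omega))
      (traceMoment_nonneg _ _) (by positivity)).trans (le_of_eq ?_)
    rw [← hab']
    ring
  -- the remaining terms
  have hrest : ∑ ab ∈ antidiagonal (2 * k), (traceMoment N (2 * k) +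
      (radMean ((polyMatrix N ^ ab.1).trace * (polyMatrix N ^ ab.2).trace) -
        traceMoment N ab.1 * traceMoment N ab.2)) ≤
      N ^ (k + 2) * c ^ k * catalan (k + 1) * (2 * K / N + 4 * K ^ 3 / N ^ 2) := by
    have hcat : (catalan k : ℝ) ≤ catalan (k + 1) := by exact_mod_cast catalan_le_succ k
    have hcov : ∀ ab ∈ antidiagonal (2 * k),
        radMean ((polyMatrix N ^ ab.1).trace * (polyMatrix N ^ ab.2).trace) -
        traceMoment N ab.1 * traceMoment N ab.2 ≤
        2 * k ^ 2 * (N ^ k * c ^ k * catalan (k + 1)) := by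
      rintro ⟨a, b⟩ hab
      replace hab := mem_antidiagonal.1 hab
      simp only at hab ⊢
      rcases k with _ | k
      · obtain ⟨rfl, rfl⟩ : a = 0 ∧ b = 0 := by omega
        have := radMean_mul_le (polyMatrix N ^ 0).trace (polyMatrix N ^ 0).trace
        simp only [pow_zero, Matrix.trace_one, Fintype.card_fin, Derivation.map_natCast, mul_zero,
          map_zero, Finset.sum_const_zero, add_zero] at this
        simp only [traceMoment, pow_zero, Matrix.trace_one, Fintype.card_fin]
        norm_num
        linarith
      · have h1 := radMean_trace_mul_trace_le (N := N) (n := 2 * k) a b (by omega)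
        have h2 := ih k (by omega) (by omega)
        have h3 : (a * b : ℝ) ≤ ((k + 1 : ℕ) : ℝ) ^ 2 := by
          have : (a : ℝ) + b = 2 * ((k + 1 : ℕ) : ℝ) := by exact_mod_cast hab
          nlinarith [sq_nonneg ((a : ℝ) - b)]
        have h4 : (catalan k : ℝ) ≤ catalan (k + 1 + 1) := by
          exact_mod_cast (catalan_le_succ k).trans (catalan_le_succ (k + 1))
        have h5 : traceMoment N (2 * k) ≤
            N ^ (k + 1) * c ^ (k + 1) * catalan (k + 1 + 1) := by
          refine h2.trans ?_
          gcongr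
          omega
        have h6 := mul_le_mul h3 h5 (traceMoment_nonneg _ _) (by positivity)
        nlinarith
    have hfirst : traceMoment N (2 * k) ≤ N ^ (k + 1) * c ^ k * catalan (k + 1) :=
      hT.trans (by gcongr)
    have hX : 0 ≤ (N : ℝ) ^ k * c ^ k * catalan (k + 1) := by positivity
    refine (Finset.sum_le_sum fun ab hab => add_le_add hfirst (hcov ab hab)).trans ?_
    rw [Finset.sum_const, Finset.Nat.card_antidiagonal, nsmul_eq_mul]
    have e1 : (N : ℝ) ^ (k + 2) * c ^ k * catalan (k + 1) * (2 * K / N + 4 * K ^ 3 / N ^ 2) =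
        (N ^ k * c ^ k * catalan (k + 1)) * (2 * K * N + 4 * K ^ 3) := by
      field_simp
      ring
    rw [e1]
    have e2 : ((2 * k + 1 : ℕ) : ℝ) * (N ^ (k + 1) * c ^ k * catalan (k + 1) +
        2 * k ^ 2 * (N ^ k * c ^ k * catalan (k + 1))) =
        (N ^ k * c ^ k * catalan (k + 1)) * ((2 * k + 1) * N + (2 * k + 1) * (2 * k ^ 2)) := by
      push_cast; ring
    rw [e2]
    refine mul_le_mul_of_nonneg_left (add_le_add ?_ ?_) hX
    · gcongr
      linarith
    · have : (2 * k + 1 : ℝ) * (2 * k ^ 2) ≤ (2 * K) * (2 * K ^ 2) := by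
        gcongr <;> linarith
      linarith
  calc traceMoment N (2 * (k + 1)) ≤ _ := traceMoment_add_two_le (2 * k)
    _ = ∑ ab ∈ antidiagonal (2 * k), traceMoment N ab.1 * traceMoment N ab.2 +
        ∑ ab ∈ antidiagonal (2 * k), (traceMoment N (2 * k) +
      (radMean ((polyMatrix N ^ ab.1).trace * (polyMatrix N ^ ab.2).trace) -
        traceMoment N ab.1 * traceMoment N ab.2)) := by
        rw [← Finset.sum_add_distrib]
        exact Finset.sum_congr rfl fun _ _ => by ring
    _ ≤ _ := add_le_add hprod hrest
    _ = _ := by rw [hc]; ring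

end MomentRecursion

section FirstReturn

open Finset.HasAntidiagonal

/-- The decomposition of the walks from `w` to `v ≠ w` according to the first visit of `v`. -/
lemma matrix_pow_first_passage {R n : Type*} [CommSemiring R] [Fintype n] [DecidableEq n]
    {P Q : Matrix n n R} {v : n} (hQ : ∀ i j, Q i j = if i ≠ v ∧ j ≠ v then P i j else 0)
    (m : ℕ) {w : n} (hw : w ≠ v) :
    (P ^ (m + 1)) w v = ∑ ab ∈ antidiagonal m, (Q ^ ab.1 * P) w v * (P ^ ab.2) v v := by
  induction m generalizing w with
  | zero => simp
  | succ m ih =>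
    rw [Finset.Nat.antidiagonal_succ, Finset.sum_cons, Finset.sum_map, pow_succ', Matrix.mul_apply,
      ← Finset.add_sum_erase _ _ (Finset.mem_univ v)]
    congr 1
    · simp
    · have h1 : ∑ u ∈ Finset.univ.erase v, P w u * (P ^ (m + 1)) u v =
          ∑ u ∈ Finset.univ.erase v, Q w u *
            ∑ ab ∈ antidiagonal m, (Q ^ ab.1 * P) u v * (P ^ ab.2) v v := by
        refine Finset.sum_congr rfl fun u hu => ?_
        have huv : u ≠ v := Finset.ne_of_mem_erase hu
        rw [ih huv, hQ w u, if_pos ⟨hw, huv⟩]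
      have h2 : Q w v = 0 := by simp [hQ]
      rw [h1, Finset.sum_erase _ (by rw [h2, zero_mul])]
      simp_rw [Finset.mul_sum]
      rw [Finset.sum_comm]
      refine Finset.sum_congr rfl fun ab _ => ?_
      simp only [Function.Embedding.prodMap, Function.Embedding.coeFn_mk, Prod.map,
        Function.Embedding.refl_apply]
      rw [Nat.succ_eq_add_one, pow_succ', Matrix.mul_assoc, Matrix.mul_apply, Finset.sum_mul]
      exact Finset.sum_congr rfl fun _ _ => by ring

end FirstReturn

section MomentLowerBound

open Finset.HasAntidiagonal

variable {N : ℕ}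

/-- The matrix of indeterminates, restricted to a set of vertices. -/
def polyMinor (S : Finset (Fin N)) : Matrix (Fin N) (Fin N) (MvPolynomial (Fin N × Fin N) ℕ) :=
  Matrix.of fun i j => if i ∈ S ∧ j ∈ S then polyMatrix N i j else 0

lemma radMean_X_mul_X (e : Fin N × Fin N) :
    radMean (MvPolynomial.X e * MvPolynomial.X e : MvPolynomial (Fin N × Fin N) ℕ) = 1 := by
  rw [MvPolynomial.X, MvPolynomial.monomial_mul, radMean_monomial, if_pos]
  · simp
  · intro i
    exact ⟨_, Finsupp.add_apply _ _ i⟩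

lemma catalan_le_radMean_polyMinor (k : ℕ) (S : Finset (Fin N)) {v : Fin N} (hv : v ∈ S) :
    ((S.card - k : ℕ) : ℝ) ^ k * catalan k ≤ radMean ((polyMinor S ^ (2 * k)) v v) := by
  induction k using Nat.strong_induction_on generalizing S v with
  | _ k ih =>
  rcases k with _ | k
  · simp [radMean_one]
  set s : ℕ := S.card - (k + 1) with hs
  have hQ : ∀ i j, polyMinor (S.erase v) i j = if i ≠ v ∧ j ≠ v then polyMinor S i j else 0 := by
    intro i j
    simp only [polyMinor, Matrix.of_apply, Finset.mem_erase]
    grind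
  have hterm : ∀ w ∈ S.erase v, (s : ℝ) ^ k * catalan (k + 1) ≤
      radMean (polyMinor S v w * (polyMinor S ^ (2 * k + 1)) w v) := by
    intro w hw
    have hwv := Finset.ne_of_mem_erase hw
    have hwS := Finset.mem_of_mem_erase hw
    rw [matrix_pow_first_passage hQ _ hwv, Finset.mul_sum, map_sum]
    let f : ℕ → ℕ → ℝ := fun a b => if Even a then radMean (polyMinor S v w *
      ((polyMinor (S.erase v) ^ a * polyMinor S) w v * (polyMinor S ^ b) v v)) else 0
    have hf : ∀ a b, Odd a → f a b = 0 := fun a b ha => if_neg (Nat.not_even_iff_odd.2 ha)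
    have h1 : ∑ ab ∈ antidiagonal (2 * k), f ab.1 ab.2 ≤ ∑ ab ∈ antidiagonal (2 * k),
        radMean (polyMinor S v w *
      ((polyMinor (S.erase v) ^ ab.1 * polyMinor S) w v * (polyMinor S ^ ab.2) v v)) := by
      refine Finset.sum_le_sum fun ab _ => ?_
      simp only [f]
      split_ifs
      · exact le_rfl
      · exact radMean_nonneg _
    refine le_trans ?_ h1
    rw [sum_antidiagonal_even hf, catalan_succ']
    push_cast
    rw [Finset.mul_sum]
    refine Finset.sum_le_sum fun ab hab => ?_
    have hab' := mem_antidiagonal.1 hab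
    simp only [f, if_pos (even_two_mul ab.1)]
    have h2 : (polyMinor (S.erase v) ^ (2 * ab.1) * polyMinor S) w v =
        (polyMinor (S.erase v) ^ (2 * ab.1)) w w * polyMinor S w v +
        ∑ u ∈ Finset.univ.erase w,
          (polyMinor (S.erase v) ^ (2 * ab.1)) w u * polyMinor S u v := by
      rw [Matrix.mul_apply]
      exact (Finset.add_sum_erase _ (fun u => (polyMinor (S.erase v) ^ (2 * ab.1)) w u *
        polyMinor S u v) (Finset.mem_univ w)).symm
    rw [h2, add_mul, mul_add, map_add]
    refine le_add_of_le_of_nonneg ?_ (radMean_nonneg _)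
    have h3 : polyMinor S v w = MvPolynomial.X (symmKey v w) := by
      simp only [polyMinor, Matrix.of_apply, hv, hwS, and_self, if_true]; rfl
    have h4 : polyMinor S w v = MvPolynomial.X (symmKey v w) := by
      simp only [polyMinor, Matrix.of_apply, hv, hwS, and_self, if_true, symmKey_comm v w]; rfl
    rw [h3, h4, show MvPolynomial.X (symmKey v w) * ((polyMinor (S.erase v) ^ (2 * ab.1)) w w *
      MvPolynomial.X (symmKey v w) * (polyMinor S ^ (2 * ab.2)) v v) =
      MvPolynomial.X (symmKey v w) * MvPolynomial.X (symmKey v w) *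
      ((polyMinor (S.erase v) ^ (2 * ab.1)) w w * (polyMinor S ^ (2 * ab.2)) v v) by ring]
    refine le_trans ?_ (radMean_mul_radMean_le _ _)
    rw [radMean_X_mul_X, one_mul]
    refine le_trans ?_ (radMean_mul_radMean_le _ _)
    have i1 := ih ab.1 (by omega) (S.erase v) hw
    have i2 := ih ab.2 (by omega) S hv
    rw [Finset.card_erase_of_mem hv] at i1
    refine le_trans ?_ (mul_le_mul i1 i2 (by positivity) (radMean_nonneg _))
    have j1 : (s : ℝ) ≤ ((S.card - 1 - ab.1 : ℕ) : ℝ) := by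
      exact_mod_cast (by omega : s ≤ S.card - 1 - ab.1)
    have j2 : (s : ℝ) ≤ ((S.card - ab.2 : ℕ) : ℝ) := by
      exact_mod_cast (by omega : s ≤ S.card - ab.2)
    calc (s : ℝ) ^ k * (catalan ab.1 * catalan ab.2)
        = (s ^ ab.1 * catalan ab.1) * (s ^ ab.2 * catalan ab.2) := by rw [← hab']; ring
      _ ≤ _ := by gcongr
  rw [show 2 * (k + 1) = (2 * k + 1) + 1 by ring, pow_succ' (polyMinor S), Matrix.mul_apply, map_sum]
  calc (s : ℝ) ^ (k + 1) * catalan (k + 1)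
      ≤ ((S.erase v).card : ℝ) * ((s : ℝ) ^ k * catalan (k + 1)) := by
        rw [pow_succ', mul_assoc]
        have : (s : ℝ) ≤ ((S.erase v).card : ℝ) := by
          rw [Finset.card_erase_of_mem hv]
          exact_mod_cast (by omega : s ≤ S.card - 1)
        gcongr
    _ ≤ ∑ w ∈ S.erase v, radMean (polyMinor S v w * (polyMinor S ^ (2 * k + 1)) w v) := by
        rw [← nsmul_eq_mul]
        exact Finset.card_nsmul_le_sum _ _ _ hterm
    _ ≤ _ := Finset.sum_le_sum_of_subset_of_nonneg (Finset.subset_univ _)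
        fun _ _ _ => radMean_nonneg _

theorem catalan_le_traceMoment (N k : ℕ) :
    (N : ℝ) * ((N - k : ℕ) : ℝ) ^ k * catalan k ≤ traceMoment N (2 * k) := by
  have h : polyMinor (Finset.univ : Finset (Fin N)) = polyMatrix N := by
    ext1 i j
    simp [polyMinor]
  rw [traceMoment, Matrix.trace, map_sum, mul_assoc]
  have := Finset.card_nsmul_le_sum (Finset.univ : Finset (Fin N))
    (fun v => radMean ((polyMatrix N ^ (2 * k)) v v)) (((N - k : ℕ) : ℝ) ^ k * catalan k)
    (fun v _ => by
      have := catalan_le_radMean_polyMinor k Finset.univ (Finset.mem_univ v)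
      rwa [h, Finset.card_univ, Fintype.card_fin] at this)
  rwa [Finset.card_univ, Fintype.card_fin, nsmul_eq_mul] at this

end MomentLowerBound

section NormTrace

open scoped Matrix.Norms.L2Operator

variable {N : ℕ}

lemma euclideanOpNorm_eq_norm (A : Matrix (Fin N) (Fin N) ℝ) : euclideanOpNorm A = ‖A‖ := rfl

lemma norm_pow_of_transpose_eq (hN : 0 < N) {A : Matrix (Fin N) (Fin N) ℝ} (hA : A.transpose = A) (k : ℕ) :
    ‖A ^ k‖ = ‖A‖ ^ k := by
  have : Nonempty (Fin N) := ⟨⟨0, hN⟩⟩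
  have hsa : IsSelfAdjoint A := by
    rw [IsSelfAdjoint, Matrix.star_eq_conjTranspose, Matrix.conjTranspose_eq_transpose_of_trivial, hA]
  refine le_antisymm (norm_pow_le A k) ?_
  rcases eq_or_lt_of_le (norm_nonneg A) with h0 | hpos
  · have : A = 0 := norm_eq_zero.1 h0.symm
    rcases k with _ | k
    · simp
    · simp [this]
  · have h1 := hsa.norm_pow_two_pow k
    have hk : k ≤ 2 ^ k := Nat.lt_two_pow_self.le
    have h2 : ‖A‖ ^ k * ‖A‖ ^ (2 ^ k - k) ≤ ‖A ^ k‖ * ‖A‖ ^ (2 ^ k - k) := by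
      rw [← pow_add, Nat.add_sub_cancel' hk, ← h1]
      calc ‖A ^ 2 ^ k‖ = ‖A ^ k * A ^ (2 ^ k - k)‖ := by rw [← pow_add, Nat.add_sub_cancel' hk]
        _ ≤ ‖A ^ k‖ * ‖A ^ (2 ^ k - k)‖ := norm_mul_le _ _
        _ ≤ _ := by gcongr; exact norm_pow_le _ _
    exact le_of_mul_le_mul_right h2 (by positivity)

lemma norm_sq_le_sum_sq (B : Matrix (Fin N) (Fin N) ℝ) : ‖B‖ ^ 2 ≤ ∑ i, ∑ j, B i j ^ 2 := by
  have h0 : 0 ≤ ∑ i, ∑ j, B i j ^ 2 := by positivity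
  have h : ‖B‖ ≤ √(∑ i, ∑ j, B i j ^ 2) := by
    rw [Matrix.cstar_norm_def]
    refine ContinuousLinearMap.opNorm_le_bound _ (Real.sqrt_nonneg _) fun x => ?_
    rw [EuclideanSpace.norm_eq, EuclideanSpace.norm_eq, ← Real.sqrt_mul h0]
    refine Real.sqrt_le_sqrt ?_
    simp_rw [Matrix.ofLp_toEuclideanCLM, Real.norm_eq_abs, sq_abs, Matrix.mulVec, dotProduct]
    rw [Finset.sum_mul]
    exact Finset.sum_le_sum fun i _ => Finset.sum_mul_sq_le_sq_mul_sq _ _ _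
  calc ‖B‖ ^ 2 ≤ √(∑ i, ∑ j, B i j ^ 2) ^ 2 := by gcongr
    _ = _ := Real.sq_sqrt h0

lemma sum_sq_col_le (B : Matrix (Fin N) (Fin N) ℝ) (j : Fin N) : ∑ i, B i j ^ 2 ≤ ‖B‖ ^ 2 := by
  have h := Matrix.l2_opNorm_mulVec B (EuclideanSpace.single j (1 : ℝ))
  rw [PiLp.norm_single, norm_one, mul_one, EuclideanSpace.norm_eq] at h
  have h0 : 0 ≤ ∑ i, B i j ^ 2 := by positivity
  have h' : √(∑ i, B i j ^ 2) ≤ ‖B‖ := by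
    refine le_trans (le_of_eq ?_) h
    congr 1
    refine Finset.sum_congr rfl fun i _ => ?_
    simp
  calc ∑ i, B i j ^ 2 = √(∑ i, B i j ^ 2) ^ 2 := (Real.sq_sqrt h0).symm
    _ ≤ _ := by gcongr

lemma abs_apply_le_norm (B : Matrix (Fin N) (Fin N) ℝ) (i j : Fin N) : |B i j| ≤ ‖B‖ := by
  refine abs_le_of_sq_le_sq ?_ (norm_nonneg _)
  exact (Finset.single_le_sum (f := fun i => B i j ^ 2) (fun i _ => sq_nonneg _)
    (Finset.mem_univ i)).trans (sum_sq_col_le B j)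

lemma trace_pow_two_mul {A : Matrix (Fin N) (Fin N) ℝ} (hA : A.transpose = A) (k : ℕ) :
    (A ^ (2 * k)).trace = ∑ i, ∑ j, (A ^ k) i j ^ 2 := by
  have hs : (A ^ k).transpose = A ^ k := by rw [Matrix.transpose_pow, hA]
  rw [two_mul, pow_add, Matrix.trace]
  simp_rw [Matrix.diag, Matrix.mul_apply]
  refine Finset.sum_congr rfl fun i _ => Finset.sum_congr rfl fun j _ => ?_
  rw [sq]
  congr 1
  rw [← Matrix.transpose_apply (A ^ k), hs]

lemma norm_pow_le_trace (hN : 0 < N) {A : Matrix (Fin N) (Fin N) ℝ} (hA : A.transpose = A)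
    (k : ℕ) : ‖A‖ ^ (2 * k) ≤ (A ^ (2 * k)).trace := by
  rw [trace_pow_two_mul hA, mul_comm, pow_mul, ← norm_pow_of_transpose_eq hN hA k]
  exact norm_sq_le_sum_sq _

lemma trace_pow_le (hN : 0 < N) {A : Matrix (Fin N) (Fin N) ℝ} (hA : A.transpose = A) (k : ℕ) :
    (A ^ (2 * k)).trace ≤ N * ‖A‖ ^ (2 * k) := by
  rw [trace_pow_two_mul hA, mul_comm 2 k, pow_mul, ← norm_pow_of_transpose_eq hN hA k, Finset.sum_comm]
  refine (Finset.sum_le_sum fun j _ => sum_sq_col_le _ j).trans ?_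
  simp

/-- The all-ones matrix has norm `N`. -/
lemma norm_all_ones : ‖(Matrix.of fun _ _ => 1 : Matrix (Fin N) (Fin N) ℝ)‖ = N := by
  apply le_antisymm
  · refine abs_le_of_sq_le_sq' ?_ (by positivity) |>.2
    refine (norm_sq_le_sum_sq _).trans (le_of_eq ?_)
    simp [sq]
  · rcases Nat.eq_zero_or_pos N with rfl | hN
    · simp
    have h := Matrix.l2_opNorm_mulVec (Matrix.of fun _ _ => 1 : Matrix (Fin N) (Fin N) ℝ)
      (WithLp.toLp 2 fun _ => (1 : ℝ))
    rw [EuclideanSpace.norm_eq, EuclideanSpace.norm_eq] at h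
    simp [Matrix.mulVec, dotProduct] at h
    rw [mul_comm] at h
    refine le_of_mul_le_mul_right h ?_
    positivity

end NormTrace

section SignProb

set_option linter.unusedSectionVars false

variable {σ : Type*} [Fintype σ] [DecidableEq σ]

/-- The probability of a set of configurations under independent random signs. -/
def signProb (B : Finset (σ → ℤˣ)) : ℝ := (B.card : ℝ) / 2 ^ Fintype.card σ

lemma signProb_nonneg (B : Finset (σ → ℤˣ)) : 0 ≤ signProb B := by unfold signProb; positivity

lemma card_signs : (Fintype.card (σ → ℤˣ) : ℝ) = 2 ^ Fintype.card σ := by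
  simp

lemma signProb_union_le (B C : Finset (σ → ℤˣ)) :
    signProb (B ∪ C) ≤ signProb B + signProb C := by
  unfold signProb
  rw [← add_div]
  gcongr
  exact_mod_cast Finset.card_union_le B C

lemma signProb_mul_le_signMean {B : Finset (σ → ℤˣ)} {f : (σ → ℤˣ) → ℝ} {c : ℝ}
    (hf : ∀ x, 0 ≤ f x) (hB : ∀ x ∈ B, c ≤ f x) : signProb B * c ≤ signMean f := by
  unfold signProb signMean
  rw [div_mul_eq_mul_div]
  gcongr
  rw [← nsmul_eq_mul]
  exact (Finset.card_nsmul_le_sum _ _ _ hB).trans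
    (Finset.sum_le_sum_of_subset_of_nonneg (Finset.subset_univ _) fun x _ _ => hf x)

lemma signMean_le_of_split {B : Finset (σ → ℤˣ)} {f : (σ → ℤˣ) → ℝ} {a b : ℝ}
    (ha : 0 ≤ a) (hB : ∀ x ∈ B, f x ≤ b) (hBc : ∀ x ∉ B, f x ≤ a) :
    signMean f ≤ a + b * signProb B := by
  have h : ∑ x, f x ≤ 2 ^ Fintype.card σ * a + B.card * b := by
    rw [← Finset.sum_add_sum_compl B, add_comm]
    refine add_le_add ?_ ?_
    · refine (Finset.sum_le_card_nsmul Bᶜ f a fun x hx => hBc x (Finset.mem_compl.1 hx)).trans ?_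
      rw [nsmul_eq_mul, ← card_signs]
      gcongr
      exact Finset.card_le_univ _
    · refine (Finset.sum_le_card_nsmul B f b hB).trans ?_
      rw [nsmul_eq_mul]
  unfold signMean signProb
  rw [div_le_iff₀ (by positivity)]
  refine h.trans (le_of_eq ?_)
  field_simp

end SignProb

section UpperTail

open scoped Matrix.Norms.L2Operator

/-- The symmetric matrix of a sign configuration. -/
def signMatrix {N : ℕ} (x : Fin N × Fin N → ℤˣ) : Matrix (Fin N) (Fin N) ℝ :=
  symmMatrix (signVec x)

/-- The configurations for which the norm of the matrix is at least `s`. -/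
def normGE (N : ℕ) (s : ℝ) : Finset (Fin N × Fin N → ℤˣ) :=
  open Classical in Finset.univ.filter fun x => s ≤ euclideanOpNorm (signMatrix x)

lemma mem_normGE {N : ℕ} {s : ℝ} {x : Fin N × Fin N → ℤˣ} :
    x ∈ normGE N s ↔ s ≤ euclideanOpNorm (signMatrix x) := by
  simp [normGE]

lemma signProb_normGE_mul_le {N : ℕ} (hN : 0 < N) (k : ℕ) {s : ℝ} (hs : 0 ≤ s) :
    signProb (normGE N s) * s ^ (2 * k) ≤ traceMoment N (2 * k) := by
  have h1 : ∀ x : Fin N × Fin N → ℤˣ,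
      ‖signMatrix x‖ ^ (2 * k) ≤ (signMatrix x ^ (2 * k)).trace := fun x =>
    norm_pow_le_trace hN (symmMatrix_transpose _) k
  rw [traceMoment_eq]
  refine signProb_mul_le_signMean (fun x => le_trans (by positivity) (h1 x)) fun x hx => ?_
  refine le_trans ?_ (h1 x)
  gcongr
  exact mem_normGE.1 hx

lemma catalan_le_four_pow (k : ℕ) : (catalan k : ℝ) ≤ 4 ^ k := by
  have h1 := succ_mul_catalan_eq_centralBinom k
  have h2 := Nat.centralBinom_le_four_pow k
  have : catalan k ≤ 4 ^ k := by nlinarith [Nat.zero_le (k * catalan k)]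
  exact_mod_cast this

lemma tendsto_natSqrt_atTop : Tendsto Nat.sqrt atTop atTop :=
  tendsto_atTop.2 fun b => by
    filter_upwards [eventually_ge_atTop (b * b)] with n hn
    exact Nat.le_sqrt.2 hn

lemma tendsto_pow_mul_pow_sqrt {ρ : ℝ} (h0 : 0 < ρ) (h1 : ρ < 1) (m : ℕ) :
    Tendsto (fun N : ℕ => (N : ℝ) ^ m * ρ ^ Nat.sqrt N) atTop (𝓝 0) := by
  have h := (tendsto_pow_const_mul_const_pow_of_abs_lt_one (2 * m)
    (by rwa [abs_of_pos h0] : |ρ| < 1)).comp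
    ((tendsto_add_atTop_nat 1).comp tendsto_natSqrt_atTop)
  have h' := h.const_mul ρ⁻¹
  rw [mul_zero] at h'
  refine squeeze_zero (fun N => by positivity) (fun N => ?_) h'
  have hN : (N : ℝ) ≤ ((Nat.sqrt N + 1 : ℕ) : ℝ) ^ 2 := by
    exact_mod_cast (Nat.lt_succ_sqrt' N).le
  simp only [Function.comp_apply]
  calc (N : ℝ) ^ m * ρ ^ Nat.sqrt N ≤ (((Nat.sqrt N + 1 : ℕ) : ℝ) ^ 2) ^ m * ρ ^ Nat.sqrt N := by
        gcongr
    _ = _ := by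
        rw [pow_succ ρ, ← pow_mul]
        field_simp

/-- The norm of a symmetric random sign matrix exceeds `(2 + ε) √N` with a probability
that decays faster than any power of `N`. -/
theorem eventually_signProb_normGE {ε : ℝ} (hε : 0 < ε) (m : ℕ) :
    ∀ᶠ N : ℕ in atTop, signProb (normGE N ((2 + ε) * √N)) * N ^ m ≤ 1 := by
  have h4 : 4 / (2 + ε) ^ 2 < 1 := by
    rw [div_lt_one (by positivity)]; nlinarith
  obtain ⟨ρ, hρ1, hρ2⟩ := exists_between h4
  have hρ0 : 0 < ρ := lt_trans (by positivity) hρ1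
  have hc : Tendsto (fun N : ℕ => 4 * (1 + 6 / (Nat.sqrt N : ℝ)) / (2 + ε) ^ 2) atTop
      (𝓝 (4 * (1 + 0) / (2 + ε) ^ 2)) := by
    refine Tendsto.div_const (Tendsto.const_mul _ (Tendsto.const_add _ ?_)) _
    exact (tendsto_const_div_atTop_nhds_zero_nat 6).comp tendsto_natSqrt_atTop
  rw [add_zero, mul_one] at hc
  filter_upwards [hc.eventually_lt_const hρ1,
    (tendsto_pow_mul_pow_sqrt hρ0 hρ2 (m + 1)).eventually_le_const one_pos,
    eventually_gt_atTop 0, tendsto_natSqrt_atTop.eventually_gt_atTop 0] with N h1 h2 hN hK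
  set K := Nat.sqrt N
  have hN' : (0 : ℝ) < N := by exact_mod_cast hN
  have hK' : (0 : ℝ) < K := by exact_mod_cast hK
  have hKN : (K : ℝ) ^ 2 ≤ N := by exact_mod_cast Nat.sqrt_le' N
  have hT := traceMoment_le_catalan K hN K le_rfl
  have hcK : 1 + (2 * K / N + 4 * K ^ 3 / N ^ 2 : ℝ) ≤ 1 + 6 / K := by
    have e1 : (2 * K / N : ℝ) ≤ 2 / K := by
      rw [div_le_div_iff₀ hN' hK']; nlinarith
    have e2 : (4 * K ^ 3 / N ^ 2 : ℝ) ≤ 4 / K := by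
      rw [div_le_div_iff₀ (by positivity) hK']
      nlinarith [mul_le_mul hKN hKN (by positivity) hN'.le]
    have e3 : (2 / K + 4 / K : ℝ) = 6 / K := by ring
    linarith
  have hP := signProb_normGE_mul_le hN K (s := (2 + ε) * √N) (by positivity)
  have hs : ((2 + ε) * √N) ^ (2 * K) = ((2 + ε) ^ 2) ^ K * (N : ℝ) ^ K := by
    rw [pow_mul, mul_pow, Real.sq_sqrt hN'.le, mul_pow]
  have hbound : signProb (normGE N ((2 + ε) * √N)) ≤ N * ρ ^ K := by
    have h3 : signProb (normGE N ((2 + ε) * √N)) * (((2 + ε) ^ 2) ^ K * (N : ℝ) ^ K) ≤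
        N * ρ ^ K * (((2 + ε) ^ 2) ^ K * (N : ℝ) ^ K) := by
      rw [← hs]
      refine hP.trans (hT.trans ?_)
      rw [hs]
      have h5 : 4 * (1 + 6 / (K : ℝ)) ≤ ρ * (2 + ε) ^ 2 := by
        rw [div_lt_iff₀ (by positivity)] at h1
        exact h1.le
      calc (N : ℝ) ^ (K + 1) * (1 + (2 * K / N + 4 * K ^ 3 / N ^ 2 : ℝ)) ^ K * catalan K
          ≤ (N : ℝ) ^ (K + 1) * (1 + 6 / K) ^ K * 4 ^ K := by
            gcongr
            exact catalan_le_four_pow K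
        _ = (N : ℝ) ^ (K + 1) * (4 * (1 + 6 / K)) ^ K := by rw [mul_pow]; ring
        _ ≤ (N : ℝ) ^ (K + 1) * (ρ * (2 + ε) ^ 2) ^ K := by gcongr
        _ = _ := by rw [mul_pow]; ring
    exact le_of_mul_le_mul_right h3 (by positivity)
  calc _ ≤ N * ρ ^ K * (N : ℝ) ^ m := by gcongr
    _ = (N : ℝ) ^ (m + 1) * ρ ^ K := by ring
    _ ≤ 1 := h2

end UpperTail

section CubeConcentration

lemma half_exp_add_exp_le {a b l : ℝ} (h : |a - b| ≤ 1) :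
    (Real.exp (l * a) + Real.exp (l * b)) / 2 ≤ Real.exp (l * ((a + b) / 2) + l ^ 2 / 8) := by
  have h1 : (Real.exp (l * a) + Real.exp (l * b)) / 2 =
      Real.exp (l * ((a + b) / 2)) * Real.cosh (l * (a - b) / 2) := by
    rw [Real.cosh_eq, mul_div_assoc', mul_add, ← Real.exp_add, ← Real.exp_add]
    ring_nf
  rw [h1, Real.exp_add]
  refine mul_le_mul_of_nonneg_left ((Real.cosh_le_exp_half_sq _).trans ?_) (Real.exp_pos _).le
  refine Real.exp_le_exp.2 ?_
  have : (a - b) ^ 2 ≤ 1 := by rw [← sq_abs]; nlinarith [abs_nonneg (a - b)]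
  nlinarith [mul_nonneg (sq_nonneg l) (sub_nonneg.2 this)]

lemma sum_signs_succ {n : ℕ} (f : (Fin (n + 1) → ℤˣ) → ℝ) :
    ∑ x, f x = ∑ y : Fin n → ℤˣ, (f (Fin.cons 1 y) + f (Fin.cons (-1) y)) := by
  rw [← (Fin.consEquiv fun _ => ℤˣ).sum_comp, Fintype.sum_prod_type, sum_units_int,
    ← Finset.sum_add_distrib]
  rfl

lemma signMean_exp_le_fin (l : ℝ) {n : ℕ} (g : (Fin n → ℤˣ) → ℝ)
    (hg : ∀ x i s, |g (Function.update x i s) - g x| ≤ 1) :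
    signMean (fun x => Real.exp (l * g x)) ≤ Real.exp (l * signMean g + l ^ 2 / 8 * n) := by
  induction n with
  | zero => simp [signMean]
  | succ n ih =>
    set h : (Fin n → ℤˣ) → ℝ := fun y => (g (Fin.cons 1 y) + g (Fin.cons (-1) y)) / 2 with hh
    have hmean : signMean h = signMean g := by
      simp only [signMean, hh, sum_signs_succ, Fintype.card_fin]
      rw [← Finset.sum_div, pow_succ']
      field_simp
    have hLip : ∀ x i s, |h (Function.update x i s) - h x| ≤ 1 := by
      intro x i s
      have h1 := hg (Fin.cons 1 x) i.succ s
      have h2 := hg (Fin.cons (-1) x) i.succ s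
      rw [← Fin.cons_update] at h1 h2
      simp only [hh]
      rw [abs_le] at h1 h2 ⊢
      constructor <;> linarith
    have hdiff : ∀ y : Fin n → ℤˣ, |g (Fin.cons 1 y) - g (Fin.cons (-1) y)| ≤ 1 := by
      intro y
      have := hg (Fin.cons (-1) y) 0 1
      rwa [Fin.update_cons_zero] at this
    have h3 := ih h hLip
    rw [hmean] at h3
    have h4 : signMean (fun x => Real.exp (l * g x)) ≤
        Real.exp (l ^ 2 / 8) * signMean (fun y => Real.exp (l * h y)) := by
      simp only [signMean, Fintype.card_fin]
      rw [sum_signs_succ, pow_succ', mul_div_assoc', div_le_div_iff₀ (by positivity) (by positivity)]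
      have : ∑ y : Fin n → ℤˣ, (Real.exp (l * g (Fin.cons 1 y)) +
          Real.exp (l * g (Fin.cons (-1) y))) ≤
          2 * (Real.exp (l ^ 2 / 8) * ∑ y, Real.exp (l * h y)) := by
        rw [Finset.mul_sum, Finset.mul_sum]
        refine Finset.sum_le_sum fun y _ => ?_
        have := half_exp_add_exp_le (l := l) (hdiff y)
        rw [Real.exp_add] at this
        simp only [hh]
        linarith
      have hp : (0 : ℝ) < 2 ^ n := by positivity
      nlinarith
    refine h4.trans ((mul_le_mul_of_nonneg_left h3 (Real.exp_pos _).le).trans (le_of_eq ?_))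
    rw [← Real.exp_add]
    push_cast
    ring_nf

set_option linter.unusedSectionVars false

variable {σ : Type*} [Fintype σ] [DecidableEq σ]

/-- Gaussian concentration on the cube for functions with bounded differences. -/
lemma signMean_exp_le (l : ℝ) (g : (σ → ℤˣ) → ℝ)
    (hg : ∀ x i s, |g (Function.update x i s) - g x| ≤ 1) :
    signMean (fun x => Real.exp (l * g x)) ≤
      Real.exp (l * signMean g + l ^ 2 / 8 * Fintype.card σ) := by
  let e := Fintype.equivFin σ
  have hsum : ∀ f : (σ → ℤˣ) → ℝ, signMean (fun y : Fin (Fintype.card σ) → ℤˣ => f (y ∘ e)) =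
      signMean f := by
    intro f
    unfold signMean
    rw [Fintype.card_fin, ← (Equiv.arrowCongr e.symm (Equiv.refl ℤˣ)).sum_comp]
    rfl
  have h := signMean_exp_le_fin l (fun y => g (y ∘ e)) (fun x i s => by
    have := hg (x ∘ e) (e.symm i) s
    rwa [Function.update_comp_equiv])
  rw [hsum (fun x => Real.exp (l * g x)), hsum g] at h
  exact h

/-- The Hamming distance to a nonempty set of configurations. -/
def distTo (B : Finset (σ → ℤˣ)) (hB : B.Nonempty) (x : σ → ℤˣ) : ℕ :=
  B.inf' hB fun y => hammingDist x y

lemma distTo_le_add (B : Finset (σ → ℤˣ)) (hB : B.Nonempty) (x y : σ → ℤˣ) :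
    distTo B hB x ≤ hammingDist x y + distTo B hB y := by
  obtain ⟨z, hz, hz'⟩ := Finset.exists_mem_eq_inf' hB fun z => hammingDist y z
  unfold distTo
  rw [hz']
  exact (Finset.inf'_le _ hz).trans (hammingDist_triangle x y z)

lemma hammingDist_update_le (x : σ → ℤˣ) (i : σ) (s : ℤˣ) :
    hammingDist (Function.update x i s) x ≤ 1 := by
  unfold hammingDist
  refine (Finset.card_le_card (t := {i}) fun j hj => ?_).trans (by simp)
  by_contra h
  simp at h hj
  simp [h] at hj

/-- Large sets of configurations are close to almost every configuration. -/
lemma signProb_mul_signProb_distTo_le (B : Finset (σ → ℤˣ)) (hB : B.Nonempty) {D : ℝ} (hD : 0 ≤ D)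
    (C : Finset (σ → ℤˣ)) (hC : ∀ x ∈ C, D ≤ distTo B hB x) (hσ : 0 < Fintype.card σ) :
    signProb B * signProb C ≤ Real.exp (-(D ^ 2 / Fintype.card σ)) := by
  set n : ℝ := ((Fintype.card σ : ℕ) : ℝ) with hn
  have hn0 : 0 < n := by rw [hn]; exact_mod_cast hσ
  set g : (σ → ℤˣ) → ℝ := fun x => distTo B hB x with hg
  have hLip : ∀ x i s, |g (Function.update x i s) - g x| ≤ 1 := by
    intro x i s
    have h1 := distTo_le_add B hB (Function.update x i s) x
    have h2 := distTo_le_add B hB x (Function.update x i s)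
    have h3 := hammingDist_update_le x i s
    have h4 := hammingDist_comm x (Function.update x i s)
    have h5 : distTo B hB (Function.update x i s) ≤ 1 + distTo B hB x := by omega
    have h6 : distTo B hB x ≤ 1 + distTo B hB (Function.update x i s) := by omega
    have h5' : g (Function.update x i s) ≤ 1 + g x := by simp only [hg]; exact_mod_cast h5
    have h6' : g x ≤ 1 + g (Function.update x i s) := by simp only [hg]; exact_mod_cast h6
    rw [abs_le]
    constructor <;> linarith
  set l : ℝ := 2 * D / n with hl
  have hl0 : 0 ≤ l := by positivity
  have h1 := signMean_exp_le l g hLip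
  have h2 := signMean_exp_le (-l) g hLip
  have hBm : signProb B * 1 ≤ signMean fun x => Real.exp (-l * g x) := by
    refine signProb_mul_le_signMean (fun x => (Real.exp_pos _).le) fun x hx => ?_
    have : distTo B hB x = 0 := by
      have := Finset.inf'_le (fun y => hammingDist x y) hx
      simpa [distTo] using this
    simp [hg, this]
  have hCm : signProb C * Real.exp (l * D) ≤ signMean fun x => Real.exp (l * g x) := by
    refine signProb_mul_le_signMean (fun x => (Real.exp_pos _).le) fun x hx => ?_
    exact Real.exp_le_exp.2 (mul_le_mul_of_nonneg_left (hC x hx) hl0)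
  have h3 := mul_le_mul (hBm.trans h2) (hCm.trans h1)
    (mul_nonneg (signProb_nonneg _) (Real.exp_pos _).le) (Real.exp_pos _).le
  rw [← Real.exp_add] at h3
  have h4 : signProb B * signProb C * Real.exp (l * D) ≤ Real.exp (l ^ 2 / 4 * n) := by
    refine (le_of_eq (by ring)).trans (h3.trans (le_of_eq ?_))
    congr 1
    ring
  rw [← le_div_iff₀ (Real.exp_pos _), ← Real.exp_sub] at h4
  refine h4.trans (Real.exp_le_exp.2 (le_of_eq ?_))
  rw [hl]
  field_simp
  ring

end CubeConcentration

section LowerTail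

open Finset.HasAntidiagonal
open scoped Matrix.Norms.L2Operator

variable {N : ℕ}

lemma pow_succ_sub_pow_succ {R : Type*} [Ring R] (A B : R) (n : ℕ) :
    A ^ (n + 1) - B ^ (n + 1) = ∑ ab ∈ antidiagonal n, A ^ ab.1 * (A - B) * B ^ ab.2 := by
  induction n with
  | zero => simp
  | succ n ih =>
    rw [Finset.Nat.antidiagonal_succ, Finset.sum_cons, Finset.sum_map]
    have : A ^ (n + 1 + 1) - B ^ (n + 1 + 1) =
        (A - B) * B ^ (n + 1) + A * (A ^ (n + 1) - B ^ (n + 1)) := by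
      rw [pow_succ' A, pow_succ' B]
      noncomm_ring
    rw [this, ih, Finset.mul_sum]
    simp [pow_succ' A, mul_assoc]

lemma sum_abs_signMatrix_sub_le (x y : Fin N × Fin N → ℤˣ) :
    ∑ i, ∑ j, |(signMatrix x - signMatrix y) i j| ≤ 4 * hammingDist x y := by
  let u : Fin N × Fin N → ℝ := fun e => if x e ≠ y e then 1 else 0
  have hu : ∑ i, ∑ j, u (i, j) = hammingDist x y := by
    rw [← Fintype.sum_prod_type' (f := fun i j => u (i, j))]
    simp only [u, Finset.sum_boole, hammingDist]
  have hu0 : ∀ e, 0 ≤ u e := fun e => by simp only [u]; split_ifs <;> norm_num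
  have hval : ∀ s t : ℤˣ, |((s : ℤ) : ℝ) - ((t : ℤ) : ℝ)| ≤ 2 * if s ≠ t then 1 else 0 := by
    intro s t
    rcases Int.units_eq_one_or s with rfl | rfl <;> rcases Int.units_eq_one_or t with rfl | rfl <;>
      norm_num
  have hij : ∀ i j, |(signMatrix x - signMatrix y) i j| ≤ 2 * (u (i, j) + u (j, i)) := by
    intro i j
    have h1 : |(signMatrix x - signMatrix y) i j| ≤ 2 * u (symmKey i j) := hval _ _
    refine h1.trans ?_
    have := hu0 (i, j)
    have := hu0 (j, i)
    unfold symmKey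
    split_ifs <;> linarith
  refine (Finset.sum_le_sum fun i _ => Finset.sum_le_sum fun j _ => hij i j).trans (le_of_eq ?_)
  simp_rw [← Finset.mul_sum, Finset.sum_add_distrib]
  rw [Finset.sum_comm (f := fun i j => u (j, i)), hu]
  ring

lemma trace_pow_sub_le (hN : 0 < N) {x y : Fin N × Fin N → ℤˣ} {R : ℝ}
    (hx : ‖signMatrix x‖ ≤ R) (hy : ‖signMatrix y‖ ≤ R) (n : ℕ) :
    (signMatrix x ^ (n + 1)).trace - (signMatrix y ^ (n + 1)).trace ≤
      (n + 1) * R ^ n * (4 * hammingDist x y) := by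
  have : Nonempty (Fin N) := ⟨⟨0, hN⟩⟩
  have hR : 0 ≤ R := (norm_nonneg _).trans hx
  rw [← Matrix.trace_sub, pow_succ_sub_pow_succ, Matrix.trace_sum]
  have hterm : ∀ ab ∈ antidiagonal n, (signMatrix x ^ ab.1 * (signMatrix x - signMatrix y) *
      signMatrix y ^ ab.2).trace ≤ R ^ n * (4 * hammingDist x y) := by
    intro ab hab
    have hab' := mem_antidiagonal.1 hab
    rw [Matrix.mul_assoc, Matrix.trace_mul_comm, Matrix.mul_assoc]
    have hnorm : ‖signMatrix y ^ ab.2 * signMatrix x ^ ab.1‖ ≤ R ^ n := by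
      refine (norm_mul_le _ _).trans ?_
      rw [← hab', add_comm, pow_add]
      gcongr
      · exact (norm_pow_le _ _).trans (by gcongr)
      · exact (norm_pow_le _ _).trans (by gcongr)
    calc ((signMatrix x - signMatrix y) * (signMatrix y ^ ab.2 * signMatrix x ^ ab.1)).trace
        = ∑ i, ∑ j, (signMatrix x - signMatrix y) i j *
          (signMatrix y ^ ab.2 * signMatrix x ^ ab.1) j i := by
          rw [Matrix.trace]; simp_rw [Matrix.diag, Matrix.mul_apply (M := signMatrix x - _)]
      _ ≤ ∑ i, ∑ j, |(signMatrix x - signMatrix y) i j| * R ^ n := by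
          refine Finset.sum_le_sum fun i _ => Finset.sum_le_sum fun j _ => ?_
          refine (le_abs_self _).trans ?_
          rw [abs_mul]
          gcongr
          exact (abs_apply_le_norm _ _ _).trans hnorm
      _ = R ^ n * ∑ i, ∑ j, |(signMatrix x - signMatrix y) i j| := by
          simp_rw [Finset.mul_sum, mul_comm]
      _ ≤ _ := by
          gcongr
          exact sum_abs_signMatrix_sub_le x y
  refine (Finset.sum_le_sum hterm).trans (le_of_eq ?_)
  rw [Finset.sum_const, Finset.Nat.card_antidiagonal, nsmul_eq_mul]
  push_cast
  ring

lemma norm_signMatrix_le (x : Fin N × Fin N → ℤˣ) : ‖signMatrix x‖ ≤ N := by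
  refine abs_le_of_sq_le_sq' ?_ (by positivity) |>.2
  refine (norm_sq_le_sum_sq _).trans (le_of_eq ?_)
  have : ∀ i j, signMatrix x i j ^ 2 = 1 := by
    intro i j
    simp only [signMatrix, symmMatrix_apply, signVec]
    rcases Int.units_eq_one_or (x (symmKey i j)) with h | h <;> simp [h]
  simp [this, sq]

lemma exists_pow_lt_catalan {a : ℝ} (ha : 0 ≤ a) (ha2 : a < 2) :
    ∃ k : ℕ, 0 < k ∧ a ^ (2 * k) < catalan k := by
  have hr0 : 0 ≤ a ^ 2 / 4 := by positivity
  have hr1 : a ^ 2 / 4 < 1 := by nlinarith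
  have h := (tendsto_pow_const_mul_const_pow_of_abs_lt_one 2
    (by rwa [abs_of_nonneg hr0] : |a ^ 2 / 4| < 1)).eventually_lt_const
    (by norm_num : (0 : ℝ) < 1 / 4)
  obtain ⟨k, hk, hk0⟩ := (h.and (eventually_gt_atTop 0)).exists
  refine ⟨k, hk0, ?_⟩
  have h1 : (4 : ℝ) ^ k ≤ 2 * k * ((k + 1) * catalan k) := by
    have h2 := Nat.four_pow_le_two_mul_self_mul_centralBinom k hk0
    rw [← succ_mul_catalan_eq_centralBinom] at h2
    exact_mod_cast h2
  have hk1 : (1 : ℝ) ≤ k := by exact_mod_cast hk0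
  rw [div_pow, ← pow_mul, mul_div_assoc', div_lt_iff₀ (by positivity)] at hk
  have h3 : 2 * (k : ℝ) * ((k + 1) * catalan k) ≤ 4 * k ^ 2 * catalan k := by
    have : 2 * (k : ℝ) * (k + 1) ≤ 4 * k ^ 2 := by nlinarith
    have hc : (0 : ℝ) ≤ catalan k := by positivity
    nlinarith
  have h4 : (k : ℝ) ^ 2 * a ^ (2 * k) < k ^ 2 * catalan k := by linarith
  exact lt_of_mul_lt_mul_left h4 (by positivity)

/-- The configurations for which the norm of the matrix is at most `s`. -/
def normLE (N : ℕ) (s : ℝ) : Finset (Fin N × Fin N → ℤˣ) :=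
  open Classical in Finset.univ.filter fun x => euclideanOpNorm (signMatrix x) ≤ s

lemma mem_normLE {s : ℝ} {x : Fin N × Fin N → ℤˣ} :
    x ∈ normLE N s ↔ euclideanOpNorm (signMatrix x) ≤ s := by
  simp [normLE]

/-- On the set of configurations with norm at most `3 √N` that are close to a configuration of
norm at most `a √N`, the trace of the power `2 k` is bounded. -/
lemma trace_pow_le_of_distTo_lt (hN : 0 < N) {a D : ℝ} (ha2 : a ≤ 3) {k : ℕ}
    (hk : 0 < k) (hB : (normLE N (a * √N)).Nonempty) {x : Fin N × Fin N → ℤˣ}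
    (hx : x ∉ normGE N (3 * √N)) (hd : distTo _ hB x < D) :
    (signMatrix x ^ (2 * k)).trace ≤
      N * (a * √N) ^ (2 * k) + 2 * k * (3 * √N) ^ (2 * k - 1) * (4 * D) := by
  obtain ⟨y, hy, hxy⟩ := Finset.exists_mem_eq_inf' hB fun z => hammingDist x z
  have hyn : ‖signMatrix y‖ ≤ a * √N := mem_normLE.1 hy
  have hxn : ‖signMatrix x‖ ≤ 3 * √N := by
    rw [mem_normGE] at hx
    exact (not_le.1 hx).le
  have h1 := trace_pow_sub_le hN hxn (hyn.trans (by gcongr)) (2 * k - 1)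
  rw [Nat.sub_add_cancel (by omega)] at h1
  have h2 := trace_pow_le hN (symmMatrix_transpose (signVec y)) k
  have h3 : (hammingDist x y : ℝ) ≤ D := by
    rw [← hxy]
    exact hd.le
  have h4 : (((2 * k - 1 : ℕ) : ℝ) + 1) = 2 * k := by
    have : (2 * k - 1) + 1 = 2 * k := by omega
    exact_mod_cast this
  rw [h4] at h1
  have h5 : (N : ℝ) * ‖symmMatrix (signVec y)‖ ^ (2 * k) ≤ N * (a * √N) ^ (2 * k) := by
    gcongr
    exact hyn
  have h6 : 2 * (k : ℝ) * (3 * √N) ^ (2 * k - 1) * (4 * hammingDist x y) ≤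
      2 * k * (3 * √N) ^ (2 * k - 1) * (4 * D) := by gcongr
  have h7 : (signMatrix y ^ (2 * k)).trace = (symmMatrix (signVec y) ^ (2 * k)).trace := rfl
  linarith

/-- The norm of a symmetric random sign matrix is below `a √N`, `a < 2`, with a probability
that decays faster than any power of `N`. -/
theorem eventually_signProb_normLE {a : ℝ} (ha : 0 ≤ a) (ha2 : a < 2) (m : ℕ) :
    ∀ᶠ N : ℕ in atTop, signProb (normLE N (a * √N)) * N ^ m ≤ 1 := by
  obtain ⟨k, hk, hgap⟩ := exists_pow_lt_catalan ha ha2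
  set C : ℝ := ((catalan k : ℕ) : ℝ) with hC
  set δ : ℝ := C - a ^ (2 * k) with hδ
  have hδ0 : 0 < δ := sub_pos.2 hgap
  set η : ℝ := δ / (16 * k * 3 ^ (2 * k - 1)) with hη
  have hk0 : (0 : ℝ) < k := by exact_mod_cast hk
  have hη0 : 0 < η := by positivity
  have hη' : 2 * k * 3 ^ (2 * k - 1) * (4 * η) = δ / 2 := by
    rw [hη]; field_simp; norm_num
  have hr : |Real.exp (-η ^ 2)| < 1 := by
    rw [abs_of_pos (Real.exp_pos _), Real.exp_lt_one_iff]
    have : 0 < η ^ 2 := by positivity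
    linarith
  have E1 : Tendsto (fun N : ℕ => (((N - k : ℕ) : ℝ) / N) ^ k * C) atTop (𝓝 ((1 - 0) ^ k * C)) := by
    refine Tendsto.mul_const _ (Tendsto.pow ?_ k)
    refine ((tendsto_const_div_atTop_nhds_zero_nat (k : ℝ)).const_sub 1).congr' ?_
    filter_upwards [eventually_ge_atTop k, eventually_gt_atTop 0] with N h h0
    have : (N : ℝ) ≠ 0 := by positivity
    rw [Nat.cast_sub h]
    field_simp
  rw [sub_zero, one_pow, one_mul] at E1
  have E2 := tendsto_pow_const_mul_const_pow_of_abs_lt_one (k + m) hr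
  have E3 := tendsto_const_div_atTop_nhds_zero_nat (1 : ℝ)
  filter_upwards [E1.eventually_const_lt (by linarith : C - δ / 4 < C),
    E2.eventually_lt_const (by linarith : 0 < δ / 8), E3.eventually_lt_const (by linarith : 0 < δ / 8),
    eventually_signProb_normGE one_pos (k + 1), eventually_gt_atTop 0] with N e1 e2 e3 e4 hN
  by_contra hcon
  push Not at hcon
  have hN' : (0 : ℝ) < N := by exact_mod_cast hN
  rw [show (2 + 1 : ℝ) = 3 by norm_num] at e4
  have hpos : 0 < signProb (normLE N (a * √N)) := by
    by_contra h
    have h0 : signProb (normLE N (a * √N)) = 0 := le_antisymm (not_lt.1 h) (signProb_nonneg _)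
    rw [h0, zero_mul] at hcon
    linarith
  have hB : (normLE N (a * √N)).Nonempty := by
    rw [Finset.nonempty_iff_ne_empty]
    intro h
    rw [h] at hpos
    simp [signProb] at hpos
  set D : ℝ := η * (N * √N) with hD
  have hD0 : 0 ≤ D := by positivity
  classical
  set F : Finset (Fin N × Fin N → ℤˣ) := Finset.univ.filter fun x => D ≤ distTo _ hB x with hF
  have hF1 := signProb_mul_signProb_distTo_le _ hB hD0 F (fun x hx => by simpa [hF] using hx)
    (by simp; exact hN.ne')
  have hexp : D ^ 2 / (Fintype.card (Fin N × Fin N) : ℕ) = η ^ 2 * N := by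
    rw [hD, Fintype.card_prod, Fintype.card_fin, mul_pow, mul_pow, Real.sq_sqrt hN'.le]
    push_cast
    field_simp
  rw [hexp] at hF1
  have hF2 : signProb F ≤ N ^ m * Real.exp (-η ^ 2) ^ N := by
    rw [← Real.exp_nat_mul, show (N : ℝ) * -η ^ 2 = -(η ^ 2 * N) by ring]
    have h1 : signProb F ≤ signProb F * (signProb (normLE N (a * √N)) * N ^ m) :=
      le_mul_of_one_le_right (signProb_nonneg _) hcon.le
    have h2 := mul_le_mul_of_nonneg_left hF1 (by positivity : (0 : ℝ) ≤ (N : ℝ) ^ m)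
    linarith
  have hsqrt : (√N : ℝ) ^ (2 * k) = N ^ k := by rw [pow_mul, Real.sq_sqrt hN'.le]
  have hgood : ∀ x ∉ F ∪ normGE N (3 * √N),
      (symmMatrix (signVec x) ^ (2 * k)).trace ≤ N ^ (k + 1) * (C - δ / 2) := by
    intro x hx
    rw [Finset.mem_union, not_or] at hx
    have hd : (distTo _ hB x : ℝ) < D := by simpa [hF] using hx.1
    refine (trace_pow_le_of_distTo_lt hN (by linarith) hk hB hx.2 hd).trans (le_of_eq ?_)
    have h1 : (3 * √N : ℝ) ^ (2 * k - 1) * √N = 3 ^ (2 * k - 1) * N ^ k := by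
      rw [mul_pow, mul_assoc, ← pow_succ, Nat.sub_add_cancel (by omega), hsqrt]
    have h2 : 2 * (k : ℝ) * (3 * √N) ^ (2 * k - 1) * (4 * D) = N ^ (k + 1) * (δ / 2) := by
      rw [hD, ← hη']
      calc _ = 2 * (k : ℝ) * ((3 * √N) ^ (2 * k - 1) * √N) * (4 * η) * N := by ring
        _ = _ := by rw [h1]; ring
    rw [h2, mul_pow, hsqrt, show a ^ (2 * k) = C - δ by rw [hδ]; ring]
    ring
  have hbad : ∀ x ∈ F ∪ normGE N (3 * √N),
      (symmMatrix (signVec x) ^ (2 * k)).trace ≤ (N : ℝ) ^ (2 * k + 1) := by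
    intro x _
    refine (trace_pow_le hN (symmMatrix_transpose _) k).trans ?_
    rw [pow_succ']
    gcongr
    exact norm_signMatrix_le x
  have ha2k : 0 ≤ a ^ (2 * k) := by positivity
  have hT := signMean_le_of_split (by
    have : 0 ≤ C - δ / 2 := by linarith
    positivity) hbad hgood
  rw [← traceMoment_eq] at hT
  have hlow := (catalan_le_traceMoment N k).trans hT
  have hU := signProb_union_le F (normGE N (3 * √N))
  have hfin : (N : ℝ) ^ (k + 1) * ((((N - k : ℕ) : ℝ) / N) ^ k * C) ≤
      N ^ (k + 1) * ((C - δ / 2) + (δ / 8 + δ / 8)) := by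
    have l1 : (N : ℝ) ^ (k + 1) * ((((N - k : ℕ) : ℝ) / N) ^ k * C) =
        N * ((N - k : ℕ) : ℝ) ^ k * C := by
      rw [div_pow]; field_simp; ring
    rw [l1]
    refine hlow.trans ?_
    rw [mul_add]
    refine add_le_add_right ?_ _
    have l2 : (N : ℝ) ^ (2 * k + 1) * signProb F ≤ N ^ (k + 1) * (δ / 8) := by
      calc (N : ℝ) ^ (2 * k + 1) * signProb F
          ≤ N ^ (2 * k + 1) * (N ^ m * Real.exp (-η ^ 2) ^ N) := by gcongr
        _ = N ^ (k + 1) * (N ^ (k + m) * Real.exp (-η ^ 2) ^ N) := by ring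
        _ ≤ _ := by gcongr
    have l3 : (N : ℝ) ^ (2 * k + 1) * signProb (normGE N (3 * √N)) ≤ N ^ (k + 1) * (δ / 8) := by
      have : (N : ℝ) ^ (2 * k + 1) * signProb (normGE N (3 * √N)) =
          N ^ (k + 1) * (signProb (normGE N (3 * √N)) * N ^ (k + 1)) * (1 / N) := by
        field_simp
        ring
      rw [this]
      calc _ ≤ (N : ℝ) ^ (k + 1) * 1 * (1 / N) := by gcongr
        _ ≤ _ := by rw [mul_one]; gcongr
    have l4 := mul_le_mul_of_nonneg_left hU (by positivity : (0 : ℝ) ≤ (N : ℝ) ^ (2 * k + 1))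
    linarith
  have := le_of_mul_le_mul_left hfin (by positivity)
  linarith

end LowerTail

section CurieWeiss

variable {ι : Type*} [Fintype ι] [DecidableEq ι]

/-- The Curie-Weiss probability of a set of configurations. -/
def cwProb (β : ℝ) (B : Finset (ι → ℤˣ)) : ℝ :=
  (curieWeissPartition ι β)⁻¹ * ∑ x ∈ B, curieWeissWeight β x

set_option linter.unusedSectionVars false

lemma curieWeissWeight_pos (β : ℝ) (x : ι → ℤˣ) : 0 < curieWeissWeight β x := Real.exp_pos _

lemma curieWeissPartition_pos (β : ℝ) : 0 < curieWeissPartition ι β :=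
  Finset.sum_pos (fun x _ => curieWeissWeight_pos β x) Finset.univ_nonempty

lemma cwProb_univ (β : ℝ) : cwProb β (Finset.univ : Finset (ι → ℤˣ)) = 1 :=
  inv_mul_cancel₀ (curieWeissPartition_pos β).ne'

/-- Curie-Weiss variables realize an event at most with the Curie-Weiss probability of the
configurations that belong to it. -/
lemma IsCurieWeiss.measure_le {Ω : Type*} [MeasurableSpace Ω] {P : Measure Ω}
    [IsProbabilityMeasure P] {β : ℝ} {ξ : ι → Ω → ℝ} (h : IsCurieWeiss P β ξ)
    (S : Set (ι → ℝ)) (B : Finset (ι → ℤˣ)) (hB : ∀ x, signVec x ∈ S → x ∈ B) :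
    P {ω | (fun i => ξ i ω) ∈ S} ≤ ENNReal.ofReal (cwProb β B) := by
  let E : (ι → ℤˣ) → Set Ω := fun x => {ω | ∀ i, ξ i ω = ((x i : ℤ) : ℝ)}
  have hEm : ∀ x, MeasurableSet (E x) := by
    intro x
    have : E x = ⋂ i, ξ i ⁻¹' {((x i : ℤ) : ℝ)} := by ext ω; simp [E]
    rw [this]
    exact MeasurableSet.iInter fun i => h.measurable i (measurableSet_singleton _)
  have hEd : Pairwise (Function.onFun Disjoint E) := by
    intro x y hxy
    refine Set.disjoint_left.2 fun ω hx hy => hxy ?_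
    ext i
    have := (hx i).symm.trans (hy i)
    exact_mod_cast this
  have hsum : ∀ C : Finset (ι → ℤˣ), P (⋃ x ∈ C, E x) = ENNReal.ofReal (cwProb β C) := by
    intro C
    rw [measure_biUnion_finset (fun x _ y _ hxy => hEd hxy) fun x _ => hEm x, cwProb,
      Finset.mul_sum, ENNReal.ofReal_sum_of_nonneg]
    · exact Finset.sum_congr rfl fun x _ => h.prob_eq x
    · intro x _
      exact mul_nonneg (inv_nonneg.2 (curieWeissPartition_pos β).le) (curieWeissWeight_pos β x).le
  have hnull : P (⋃ x ∈ (Finset.univ : Finset (ι → ℤˣ)), E x)ᶜ = 0 := by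
    rw [prob_compl_eq_zero_iff (Finset.measurableSet_biUnion _ fun x _ => hEm x), hsum, cwProb_univ,
      ENNReal.ofReal_one]
  have hsub : {ω | (fun i => ξ i ω) ∈ S} ⊆
      (⋃ x ∈ B, E x) ∪ (⋃ x ∈ (Finset.univ : Finset (ι → ℤˣ)), E x)ᶜ := by
    intro ω hω
    by_cases hu : ω ∈ ⋃ x ∈ (Finset.univ : Finset (ι → ℤˣ)), E x
    · left
      simp only [Set.mem_iUnion, Finset.mem_univ, exists_prop, true_and] at hu ⊢
      obtain ⟨x, hx⟩ := hu
      refine ⟨x, hB x ?_, hx⟩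
      have : signVec x = fun i => ξ i ω := funext fun i => (hx i).symm
      rw [this]
      exact hω
    · exact Or.inr hu
  calc _ ≤ _ := measure_mono hsub
    _ ≤ _ := measure_union_le _ _
    _ = _ := by rw [hnull, add_zero, hsum]

/-! ### Linearization of the quadratic interaction by a Gaussian integral -/

lemma exp_quadratic_eq {b : ℝ} (hb : 0 < b) (s y : ℝ) :
    Real.exp (-b * y ^ 2) * Real.exp (y * s) =
      Real.exp (s ^ 2 / (4 * b)) * Real.exp (-b * (y - s / (2 * b)) ^ 2) := by
  rw [← Real.exp_add, ← Real.exp_add]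
  congr 1
  field_simp
  ring

lemma integrable_exp_quadratic {b : ℝ} (hb : 0 < b) (s : ℝ) :
    Integrable fun y : ℝ => Real.exp (-b * y ^ 2) * Real.exp (y * s) := by
  simp_rw [exp_quadratic_eq hb]
  exact ((integrable_exp_neg_mul_sq hb).comp_sub_right _).const_mul _

lemma integral_exp_quadratic {b : ℝ} (hb : 0 < b) (s : ℝ) :
    ∫ y : ℝ, Real.exp (-b * y ^ 2) * Real.exp (y * s) =
      √(Real.pi / b) * Real.exp (s ^ 2 / (4 * b)) := by
  simp_rw [exp_quadratic_eq hb]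
  rw [integral_const_mul, integral_sub_right_eq_self (fun y => Real.exp (-b * y ^ 2)),
    integral_gaussian, mul_comm]

/-- The law of a spin configuration with independent spins of mean `tanh y`. -/
def tiltWeight (y : ℝ) (x : ι → ℤˣ) : ℝ :=
  ∏ i, (Real.exp (y * ((x i : ℤ) : ℝ)) / (2 * Real.cosh y))

/-- The probability of a set of configurations with independent spins of mean `tanh y`. -/
def tiltProb (y : ℝ) (B : Finset (ι → ℤˣ)) : ℝ := ∑ x ∈ B, tiltWeight y x

lemma tiltWeight_nonneg (y : ℝ) (x : ι → ℤˣ) : 0 ≤ tiltWeight y x :=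
  Finset.prod_nonneg fun i _ => by have := Real.cosh_pos y; positivity

lemma tiltProb_nonneg (y : ℝ) (B : Finset (ι → ℤˣ)) : 0 ≤ tiltProb y B :=
  Finset.sum_nonneg fun x _ => tiltWeight_nonneg y x

lemma exp_mul_sum_eq (y : ℝ) (x : ι → ℤˣ) : Real.exp (y * ∑ i, ((x i : ℤ) : ℝ)) =
    (2 * Real.cosh y) ^ Fintype.card ι * tiltWeight y x := by
  have := Real.cosh_pos y
  rw [tiltWeight, Finset.prod_div_distrib, Finset.prod_const, Finset.card_univ, ← Real.exp_sum,
    Finset.mul_sum]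
  field_simp

lemma sum_tilt_prod (y : ℝ) (f : ι → ℤˣ → ℝ) :
    ∑ x : ι → ℤˣ, tiltWeight y x * ∏ i, f i (x i) =
      ∏ i, ((Real.exp y * f i 1 + Real.exp (-y) * f i (-1)) / (2 * Real.cosh y)) := by
  simp_rw [tiltWeight, ← Finset.prod_mul_distrib]
  rw [sum_prod_units fun i s => Real.exp (y * ((s : ℤ) : ℝ)) / (2 * Real.cosh y) * f i s]
  refine Finset.prod_congr rfl fun i _ => ?_
  simp
  ring

lemma exp_add_exp_neg_div (y : ℝ) : (Real.exp y + Real.exp (-y)) / (2 * Real.cosh y) = 1 := by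
  have := Real.cosh_pos y
  rw [div_eq_one_iff_eq (by positivity), Real.cosh_eq]
  ring

lemma sum_tiltWeight (y : ℝ) : ∑ x : ι → ℤˣ, tiltWeight y x = 1 := by
  have := sum_tilt_prod y (fun (_ : ι) _ => 1)
  simp only [Finset.prod_const_one, mul_one, exp_add_exp_neg_div] at this
  exact this

lemma tiltProb_le_one (y : ℝ) (B : Finset (ι → ℤˣ)) : tiltProb y B ≤ 1 := by
  rw [← sum_tiltWeight (ι := ι) y]
  exact Finset.sum_le_sum_of_subset_of_nonneg (Finset.subset_univ _)
    fun x _ _ => tiltWeight_nonneg y x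

/-- The mixing density of the Curie-Weiss model is a power of this function. -/
def cwDensity (β y : ℝ) : ℝ := Real.cosh y * Real.exp (-(y ^ 2 / (2 * β)))

lemma cwDensity_pos (β y : ℝ) : 0 < cwDensity β y := mul_pos (Real.cosh_pos y) (Real.exp_pos _)

lemma continuous_cwDensity (β : ℝ) : Continuous (cwDensity β) := by
  unfold cwDensity; fun_prop

lemma exp_mul_exp_eq_cwDensity_pow (β y : ℝ) (x : ι → ℤˣ) :
    Real.exp (-(Fintype.card ι / (2 * β)) * y ^ 2) * Real.exp (y * ∑ i, ((x i : ℤ) : ℝ)) =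
    2 ^ Fintype.card ι * (cwDensity β y ^ Fintype.card ι * tiltWeight y x) := by
  rw [exp_mul_sum_eq, cwDensity, mul_pow, mul_pow, ← Real.exp_nat_mul]
  rw [show -((Fintype.card ι : ℝ) / (2 * β)) * y ^ 2 = Fintype.card ι * -(y ^ 2 / (2 * β)) by ring]
  ring

lemma integrable_cwDensity_pow_mul_tiltWeight {β : ℝ} (hβ : 0 < β) (hι : 0 < Fintype.card ι)
    (x : ι → ℤˣ) : Integrable fun y => cwDensity β y ^ Fintype.card ι * tiltWeight y x := by
  have h := integrable_exp_quadratic (b := Fintype.card ι / (2 * β))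
    (by have : (0 : ℝ) < Fintype.card ι := by exact_mod_cast hι
        positivity) (∑ i, ((x i : ℤ) : ℝ))
  simp_rw [exp_mul_exp_eq_cwDensity_pow] at h
  refine (h.const_mul (2 ^ Fintype.card ι)⁻¹).congr (Eventually.of_forall fun y => ?_)
  simp only
  field_simp

lemma curieWeissWeight_eq_integral {β : ℝ} (hβ : 0 < β) (hι : 0 < Fintype.card ι) (x : ι → ℤˣ) :
    curieWeissWeight β x = (√(Real.pi / (Fintype.card ι / (2 * β))))⁻¹ * 2 ^ Fintype.card ι *
      ∫ y, cwDensity β y ^ Fintype.card ι * tiltWeight y x := by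
  have hM : (0 : ℝ) < Fintype.card ι := by exact_mod_cast hι
  have hb : 0 < Fintype.card ι / (2 * β) := by positivity
  have h := integral_exp_quadratic hb (∑ i, ((x i : ℤ) : ℝ))
  simp_rw [exp_mul_exp_eq_cwDensity_pow] at h
  rw [integral_const_mul] at h
  have hs : 0 < √(Real.pi / (Fintype.card ι / (2 * β))) := by
    have := Real.pi_pos
    positivity
  rw [mul_assoc, h, inv_mul_cancel_left₀ hs.ne', curieWeissWeight]
  congr 1
  field_simp
  ring

lemma integrable_cwDensity_pow_mul_tiltProb {β : ℝ} (hβ : 0 < β) (hι : 0 < Fintype.card ι)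
    (B : Finset (ι → ℤˣ)) : Integrable fun y => cwDensity β y ^ Fintype.card ι * tiltProb y B := by
  simp_rw [tiltProb, Finset.mul_sum]
  exact integrable_finsetSum _ fun x _ => integrable_cwDensity_pow_mul_tiltWeight hβ hι x

lemma sum_curieWeissWeight_eq_integral {β : ℝ} (hβ : 0 < β) (hι : 0 < Fintype.card ι)
    (B : Finset (ι → ℤˣ)) :
    ∑ x ∈ B, curieWeissWeight β x =
      (√(Real.pi / (Fintype.card ι / (2 * β))))⁻¹ * 2 ^ Fintype.card ι *
      ∫ y, cwDensity β y ^ Fintype.card ι * tiltProb y B := by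
  simp_rw [tiltProb, Finset.mul_sum]
  rw [integral_finsetSum _ fun x _ => integrable_cwDensity_pow_mul_tiltWeight hβ hι x,
    Finset.mul_sum]
  exact Finset.sum_congr rfl fun x _ => curieWeissWeight_eq_integral hβ hι x

lemma curieWeissPartition_eq_integral {β : ℝ} (hβ : 0 < β) (hι : 0 < Fintype.card ι) :
    curieWeissPartition ι β = (√(Real.pi / (Fintype.card ι / (2 * β))))⁻¹ * 2 ^ Fintype.card ι *
      ∫ y, cwDensity β y ^ Fintype.card ι := by
  have := sum_curieWeissWeight_eq_integral hβ hι (Finset.univ : Finset (ι → ℤˣ))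
  simp_rw [tiltProb, sum_tiltWeight, mul_one] at this
  exact this

lemma integrable_cwDensity_pow {β : ℝ} (hβ : 0 < β) {M : ℕ} (hM : 0 < M) :
    Integrable fun y => cwDensity β y ^ M := by
  have := integrable_cwDensity_pow_mul_tiltProb hβ (ι := Fin M) (by simpa using hM) Finset.univ
  simp_rw [tiltProb, sum_tiltWeight, mul_one, Fintype.card_fin] at this
  exact this

lemma integral_cwDensity_pow_pos {β : ℝ} (hβ : 0 < β) {M : ℕ} (hM : 0 < M) :
    0 < ∫ y, cwDensity β y ^ M := by
  have hpos : ∀ y, 0 < cwDensity β y ^ M := fun y => pow_pos (cwDensity_pos β y) M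
  rw [integral_pos_iff_support_of_nonneg (fun y => (hpos y).le) (integrable_cwDensity_pow hβ hM)]
  have : Function.support (fun y => cwDensity β y ^ M) = Set.univ :=
    Set.eq_univ_of_forall fun y => (hpos y).ne'
  rw [this]
  simp

/-- The Curie-Weiss law is a mixture of product laws. -/
lemma cwProb_eq_integral_div {β : ℝ} (hβ : 0 < β) (hι : 0 < Fintype.card ι)
    (B : Finset (ι → ℤˣ)) :
    cwProb β B = (∫ y, cwDensity β y ^ Fintype.card ι * tiltProb y B) /
      ∫ y, cwDensity β y ^ Fintype.card ι := by
  have hM : (0 : ℝ) < Fintype.card ι := by exact_mod_cast hι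
  have hs : 0 < √(Real.pi / (Fintype.card ι / (2 * β))) := by
    have := Real.pi_pos
    positivity
  have hI := integral_cwDensity_pow_pos hβ hι
  rw [cwProb, curieWeissPartition_eq_integral hβ hι, sum_curieWeissWeight_eq_integral hβ hι]
  field_simp

/-- If a set has small probability under the product laws with parameter in `K`, its Curie-Weiss
probability is small up to the mass of the mixing density outside `K`. -/
lemma cwProb_le_of_tiltProb_le {β : ℝ} (hβ : 0 < β) (hι : 0 < Fintype.card ι)
    (B : Finset (ι → ℤˣ)) {K : Set ℝ} (hK : MeasurableSet K) {δ : ℝ} (hδ : 0 ≤ δ)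
    (h : ∀ y ∈ K, tiltProb y B ≤ δ) :
    cwProb β B ≤ δ + (∫ y in Kᶜ, cwDensity β y ^ Fintype.card ι) /
      ∫ y, cwDensity β y ^ Fintype.card ι := by
  have hI := integral_cwDensity_pow_pos hβ hι
  have hint := integrable_cwDensity_pow hβ hι
  have hint' := integrable_cwDensity_pow_mul_tiltProb hβ hι B
  have hpos : ∀ y, 0 < cwDensity β y ^ Fintype.card ι := fun y => pow_pos (cwDensity_pos β y) _
  rw [cwProb_eq_integral_div hβ hι, div_le_iff₀ hI, add_mul, div_mul_cancel₀ _ hI.ne',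
    ← integral_add_compl hK hint']
  refine add_le_add ?_ ?_
  · calc ∫ y in K, cwDensity β y ^ Fintype.card ι * tiltProb y B
        ≤ ∫ y in K, δ * cwDensity β y ^ Fintype.card ι := by
          refine setIntegral_mono_on hint'.integrableOn (hint.const_mul δ).integrableOn hK
            fun y hy => ?_
          rw [mul_comm]
          exact mul_le_mul_of_nonneg_right (h y hy) (hpos y).le
      _ ≤ ∫ y, δ * cwDensity β y ^ Fintype.card ι :=
          setIntegral_le_integral (hint.const_mul δ)
            (Eventually.of_forall fun y => mul_nonneg hδ (hpos y).le)
      _ = _ := integral_const_mul _ _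
  · refine setIntegral_mono_on hint'.integrableOn hint.integrableOn hK.compl fun y _ => ?_
    exact mul_le_of_le_one_right (hpos y).le (tiltProb_le_one y B)

/-! ### High temperature -/

lemma signMean_curieWeissWeight_le {l : ℝ} (hl0 : 0 < l) (hl1 : l < 1) (hι : 0 < Fintype.card ι) :
    signMean (fun x : ι → ℤˣ => curieWeissWeight l x) ≤ √(1 / (1 - l)) := by
  have hM : (0 : ℝ) < Fintype.card ι := by exact_mod_cast hι
  set M : ℝ := ((Fintype.card ι : ℕ) : ℝ) with hMdef
  have hb : 0 < M / (2 * l) := by positivity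
  have hb' : 0 < M / (2 * l) - M / 2 := by
    rw [sub_pos, div_lt_div_iff₀ (by norm_num) (by positivity)]
    nlinarith
  have h1 : signMean (fun x : ι → ℤˣ => curieWeissWeight l x) =
      (√(Real.pi / (M / (2 * l))))⁻¹ * ∫ y, cwDensity l y ^ Fintype.card ι := by
    have := curieWeissPartition_eq_integral hl0 hι
    rw [curieWeissPartition] at this
    rw [signMean, this, ← hMdef]
    field_simp
  have h2 : ∫ y, cwDensity l y ^ Fintype.card ι ≤ √(Real.pi / (M / (2 * l) - M / 2)) := by
    rw [← integral_gaussian]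
    refine integral_mono (integrable_cwDensity_pow hl0 hι) (integrable_exp_neg_mul_sq hb') fun y => ?_
    simp only [cwDensity]
    calc (Real.cosh y * Real.exp (-(y ^ 2 / (2 * l)))) ^ Fintype.card ι
        ≤ (Real.exp (y ^ 2 / 2) * Real.exp (-(y ^ 2 / (2 * l)))) ^ Fintype.card ι := by
          have := Real.cosh_pos y
          gcongr
          exact Real.cosh_le_exp_half_sq y
      _ = _ := by
          rw [← Real.exp_add, ← Real.exp_nat_mul]
          congr 1
          rw [← hMdef]
          ring
  rw [h1, inv_mul_le_iff₀ (by have := Real.pi_pos; positivity)]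
  refine h2.trans (le_of_eq ?_)
  rw [← Real.sqrt_mul (by have := Real.pi_pos; positivity)]
  congr 1
  have : 1 - l ≠ 0 := by linarith
  field_simp

lemma curieWeissWeight_one_le {β : ℝ} (hβ : 0 ≤ β) (x : ι → ℤˣ) : 1 ≤ curieWeissWeight β x :=
  Real.one_le_exp (by positivity)

/-- For `β < 1` the Curie-Weiss law is controlled by the law of independent random signs. -/
lemma exists_cwProb_le {β : ℝ} (hβ0 : 0 ≤ β) (hβ1 : β < 1) :
    ∃ (n : ℕ) (C : ℝ), ∀ (ι : Type) [Fintype ι] [DecidableEq ι], 0 < Fintype.card ι →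
      ∀ (B : Finset (ι → ℤˣ)) (L : ℝ), 0 < L → cwProb β B ≤ L ^ n * signProb B + C / L := by
  obtain ⟨l, hl, hl1⟩ := exists_between hβ1
  have hl0 : 0 < l := hβ0.trans_lt hl
  obtain ⟨n, hn⟩ := exists_nat_gt (β / (l - β))
  have hlβ : 0 < l - β := by linarith
  have hn0 : 0 < (n : ℝ) := lt_of_le_of_lt (by positivity) hn
  rw [div_lt_iff₀ hlβ] at hn
  refine ⟨n, √(1 / (1 - l)), fun ι _ _ hι B L hL => ?_⟩
  have hM : (0 : ℝ) < Fintype.card ι := by exact_mod_cast hι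
  have hZ : (2 : ℝ) ^ Fintype.card ι ≤ curieWeissPartition ι β := by
    rw [← card_signs, ← Finset.card_univ, ← nsmul_one]
    exact Finset.card_nsmul_le_sum _ _ _ fun x _ => curieWeissWeight_one_le hβ0 x
  have hpt : ∀ x : ι → ℤˣ, curieWeissWeight β x ≤ L ^ n + curieWeissWeight l x / L := by
    intro x
    set u : ℝ := Real.exp (β / (2 * (Fintype.card ι : ℝ)) * (∑ i, ((x i : ℤ) : ℝ)) ^ 2 / n) with hu
    have hu0 : 0 < u := Real.exp_pos _
    have h1 : curieWeissWeight β x = u ^ n := by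
      rw [hu, ← Real.exp_nat_mul, curieWeissWeight]
      congr 1
      field_simp
    have h2 : u ^ (n + 1) ≤ curieWeissWeight l x := by
      rw [hu, ← Real.exp_nat_mul, curieWeissWeight]
      refine Real.exp_le_exp.2 ?_
      have : ((n + 1 : ℕ) : ℝ) * (β / (2 * (Fintype.card ι : ℝ)) * (∑ i, ((x i : ℤ) : ℝ)) ^ 2 / n)
          = (β * (n + 1) / n) / (2 * (Fintype.card ι : ℝ)) * (∑ i, ((x i : ℤ) : ℝ)) ^ 2 := by
        push_cast
        field_simp
      rw [this]
      gcongr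
      rw [div_le_iff₀ hn0]
      linarith
    rw [h1]
    rcases le_total u L with h | h
    · exact (pow_le_pow_left₀ hu0.le h n).trans
        (le_add_of_nonneg_right (div_nonneg (curieWeissWeight_pos l x).le hL.le))
    · refine le_trans ?_ (le_add_of_nonneg_left (by positivity))
      rw [le_div_iff₀ hL]
      refine le_trans ?_ h2
      rw [pow_succ]
      gcongr
  have hsum : ∑ x ∈ B, curieWeissWeight β x ≤
      2 ^ Fintype.card ι * (L ^ n * signProb B + √(1 / (1 - l)) / L) := by
    refine (Finset.sum_le_sum fun x _ => hpt x).trans ?_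
    rw [Finset.sum_add_distrib, Finset.sum_const, nsmul_eq_mul, mul_add]
    refine add_le_add (le_of_eq ?_) ?_
    · rw [signProb]; field_simp
    · rw [← Finset.sum_div, mul_div_assoc']
      gcongr
      have h := signMean_curieWeissWeight_le hl0 hl1 hι
      rw [signMean, div_le_iff₀ (by positivity), mul_comm] at h
      exact (Finset.sum_le_sum_of_subset_of_nonneg (Finset.subset_univ _)
        fun x _ _ => (curieWeissWeight_pos l x).le).trans h
  rw [cwProb, inv_mul_le_iff₀ (curieWeissPartition_pos β)]
  refine hsum.trans (mul_le_mul_of_nonneg_right hZ ?_)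
  have := signProb_nonneg B
  positivity

end CurieWeiss

section Symmetrization

open scoped Matrix.Norms.L2Operator

variable {σ : Type*} [Fintype σ] [DecidableEq σ]

/-- The mean of a polynomial in half the difference of two independent copies of a configuration
of independent spins is at most its mean over random signs. -/
lemma sum_tiltWeight_aeval_le_radMean (y : ℝ) (p : MvPolynomial σ ℕ) :
    ∑ x : σ → ℤˣ, ∑ x' : σ → ℤˣ, tiltWeight y x * tiltWeight y x' *
      MvPolynomial.aeval (fun i => (signVec x i - signVec x' i) / 2) p ≤ radMean p := by
  have hc := Real.cosh_pos y
  induction p using MvPolynomial.induction_on' with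
  | add p q hp hq =>
    simp only [map_add, mul_add, Finset.sum_add_distrib]
    exact add_le_add hp hq
  | monomial d c =>
    have h1 : ∀ x x' : σ → ℤˣ, MvPolynomial.aeval (fun i => (signVec x i - signVec x' i) / 2)
        (MvPolynomial.monomial d c) =
        (c : ℝ) * ∏ i, ((((x i : ℤ) : ℝ) - ((x' i : ℤ) : ℝ)) / 2) ^ d i := by
      intro x x'
      rw [MvPolynomial.aeval_monomial, Finsupp.prod_fintype _ _ (by simp)]
      simp [signVec]
    set q : ℝ := Real.exp y / (2 * Real.cosh y) with hq
    set r : ℝ := Real.exp (-y) / (2 * Real.cosh y) with hr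
    have hq0 : 0 ≤ q := by positivity
    have hr0 : 0 ≤ r := by positivity
    have hqr : q + r = 1 := by rw [hq, hr, ← add_div]; exact exp_add_exp_neg_div y
    have h2 : ∑ x : σ → ℤˣ, ∑ x' : σ → ℤˣ, tiltWeight y x * tiltWeight y x' *
        ∏ i, ((((x i : ℤ) : ℝ) - ((x' i : ℤ) : ℝ)) / 2) ^ d i =
        ∏ i, (q * (q * 0 ^ d i + r * 1 ^ d i) + r * (q * (-1) ^ d i + r * 0 ^ d i)) := by
      have h3 : ∀ x : σ → ℤˣ, ∑ x' : σ → ℤˣ, tiltWeight y x * tiltWeight y x' *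
          ∏ i, ((((x i : ℤ) : ℝ) - ((x' i : ℤ) : ℝ)) / 2) ^ d i =
          tiltWeight y x * ∏ i, ((Real.exp y * ((((x i : ℤ) : ℝ) - 1) / 2) ^ d i +
            Real.exp (-y) * ((((x i : ℤ) : ℝ) + 1) / 2) ^ d i) / (2 * Real.cosh y)) := by
        intro x
        simp_rw [mul_assoc]
        rw [← Finset.mul_sum,
          sum_tilt_prod y fun i s => ((((x i : ℤ) : ℝ) - ((s : ℤ) : ℝ)) / 2) ^ d i]
        simp
      simp_rw [h3]
      rw [sum_tilt_prod y fun i s => (Real.exp y * ((((s : ℤ) : ℝ) - 1) / 2) ^ d i +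
            Real.exp (-y) * ((((s : ℤ) : ℝ) + 1) / 2) ^ d i) / (2 * Real.cosh y)]
      refine Finset.prod_congr rfl fun i _ => ?_
      rw [hq, hr]
      norm_num
      ring
    simp_rw [h1, show ∀ x x' : σ → ℤˣ, tiltWeight y x * tiltWeight y x' *
      ((c : ℝ) * ∏ i, ((((x i : ℤ) : ℝ) - ((x' i : ℤ) : ℝ)) / 2) ^ d i) =
      c * (tiltWeight y x * tiltWeight y x' *
        ∏ i, ((((x i : ℤ) : ℝ) - ((x' i : ℤ) : ℝ)) / 2) ^ d i) by intros; ring,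
      ← Finset.mul_sum]
    rw [h2, radMean_monomial]
    refine mul_le_mul_of_nonneg_left ?_ (by positivity)
    split_ifs with h
    · refine Finset.prod_le_one (fun i _ => ?_) fun i _ => ?_
      · rw [(h i).neg_one_pow]; positivity
      · have h0 : (0 : ℝ) ^ d i ≤ 1 := pow_le_one₀ le_rfl zero_le_one
        rw [(h i).neg_one_pow, one_pow]
        have : q * (q * 0 ^ d i + r * 1) + r * (q * 1 + r * 0 ^ d i) ≤
            q * (q * 1 + r * 1) + r * (q * 1 + r * 1) := by gcongr
        refine this.trans (le_of_eq ?_)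
        rw [mul_one, mul_one, hqr, mul_one, mul_one, hqr]
    · push Not at h
      obtain ⟨i, hi⟩ := h
      refine le_of_eq (Finset.prod_eq_zero (Finset.mem_univ i) ?_)
      have hodd := Nat.not_even_iff_odd.1 hi
      rw [hodd.neg_one_pow, zero_pow hodd.pos.ne', one_pow]
      ring

lemma sum_tiltWeight_mul_spin (y : ℝ) (e : σ) :
    ∑ x : σ → ℤˣ, tiltWeight y x * ((x e : ℤ) : ℝ) = Real.tanh y := by
  have hc := Real.cosh_pos y
  have h := sum_tilt_prod y fun (i : σ) s => if i = e then ((s : ℤ) : ℝ) else 1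
  simp only [Finset.prod_ite_eq', Finset.mem_univ, if_true] at h
  rw [h, Finset.prod_eq_single e]
  · rw [if_pos rfl, if_pos rfl, Real.tanh_eq_sinh_div_cosh, Real.sinh_eq]
    field_simp
    simp
    ring
  · intro i _ hi
    simp [hi, exp_add_exp_neg_div]
  · simp

variable {N : ℕ}

/-- The moments of the centered matrix with independent spins are bounded by those of a matrix of
random signs. -/
lemma sum_tiltWeight_norm_pow_le (hN : 0 < N) (y : ℝ) (k : ℕ) :
    ∑ x : Fin N × Fin N → ℤˣ, tiltWeight y x *
      ‖signMatrix x - Real.tanh y • (Matrix.of fun _ _ => 1)‖ ^ (2 * k) ≤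
      4 ^ k * traceMoment N (2 * k) := by
  have hcenter : ∀ x : Fin N × Fin N → ℤˣ, signMatrix x - Real.tanh y • (Matrix.of fun _ _ => 1) =
      ∑ x' : Fin N × Fin N → ℤˣ, tiltWeight y x' • (signMatrix x - signMatrix x') := by
    intro x
    ext i j
    rw [Matrix.sum_apply]
    simp only [Matrix.sub_apply, Matrix.smul_apply, Matrix.of_apply, smul_eq_mul, mul_one, mul_sub]
    rw [Finset.sum_sub_distrib, ← Finset.sum_mul, sum_tiltWeight, one_mul]
    congr 1
    exact (sum_tiltWeight_mul_spin y (symmKey i j)).symm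
  have hdiff : ∀ x x' : Fin N × Fin N → ℤˣ, signMatrix x - signMatrix x' =
      (2 : ℝ) • symmMatrix fun e => (signVec x e - signVec x' e) / 2 := by
    intro x x'
    ext i j
    simp only [signMatrix, Matrix.sub_apply, Matrix.smul_apply, symmMatrix_apply, smul_eq_mul]
    ring
  have hjensen : ∀ x : Fin N × Fin N → ℤˣ,
      ‖signMatrix x - Real.tanh y • (Matrix.of fun _ _ => 1)‖ ^ (2 * k) ≤
      ∑ x' : Fin N × Fin N → ℤˣ, tiltWeight y x' * (4 ^ k * ((symmMatrix fun e =>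
        (signVec x e - signVec x' e) / 2) ^ (2 * k)).trace) := by
    intro x
    calc ‖signMatrix x - Real.tanh y • (Matrix.of fun _ _ => 1)‖ ^ (2 * k)
        ≤ (∑ x' : Fin N × Fin N → ℤˣ, tiltWeight y x' * ‖signMatrix x - signMatrix x'‖) ^ (2 * k) := by
          gcongr
          rw [hcenter]
          refine (norm_sum_le _ _).trans (Finset.sum_le_sum fun x' _ => ?_)
          rw [norm_smul, Real.norm_eq_abs, abs_of_nonneg (tiltWeight_nonneg _ _)]
      _ ≤ ∑ x' : Fin N × Fin N → ℤˣ, tiltWeight y x' * ‖signMatrix x - signMatrix x'‖ ^ (2 * k) :=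
          Real.pow_arith_mean_le_arith_mean_pow _ _ _ (fun x' _ => tiltWeight_nonneg _ _)
            (sum_tiltWeight y) (fun x' _ => norm_nonneg _) _
      _ ≤ _ := by
          refine Finset.sum_le_sum fun x' _ => mul_le_mul_of_nonneg_left ?_ (tiltWeight_nonneg _ _)
          rw [hdiff, norm_smul, mul_pow, pow_mul ‖(2 : ℝ)‖]
          norm_num
          exact norm_pow_le_trace hN (symmMatrix_transpose _) k
  calc _ ≤ ∑ x : Fin N × Fin N → ℤˣ, tiltWeight y x * ∑ x' : Fin N × Fin N → ℤˣ, tiltWeight y x' *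
        (4 ^ k * ((symmMatrix fun e => (signVec x e - signVec x' e) / 2) ^ (2 * k)).trace) :=
        Finset.sum_le_sum fun x _ => mul_le_mul_of_nonneg_left (hjensen x) (tiltWeight_nonneg _ _)
    _ = 4 ^ k * ∑ x : Fin N × Fin N → ℤˣ, ∑ x' : Fin N × Fin N → ℤˣ,
        tiltWeight y x * tiltWeight y x' * MvPolynomial.aeval
          (fun e => (signVec x e - signVec x' e) / 2) (polyMatrix N ^ (2 * k)).trace := by
        simp_rw [aeval_trace_polyMatrix_pow, Finset.mul_sum]
        exact Finset.sum_congr rfl fun x _ => Finset.sum_congr rfl fun x' _ => by ring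
    _ ≤ _ := by
        refine mul_le_mul_of_nonneg_left ?_ (by positivity)
        exact sum_tiltWeight_aeval_le_radMean y _

lemma tiltProb_mul_pow_le (hN : 0 < N) (y : ℝ) (k : ℕ) {s : ℝ} (hs : 0 ≤ s)
    (B : Finset (Fin N × Fin N → ℤˣ))
    (hB : ∀ x ∈ B, s ≤ ‖signMatrix x - Real.tanh y • (Matrix.of fun _ _ => 1)‖) :
    tiltProb y B * s ^ (2 * k) ≤ 4 ^ k * traceMoment N (2 * k) := by
  refine le_trans ?_ (sum_tiltWeight_norm_pow_le hN y k)
  rw [tiltProb, Finset.sum_mul]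
  refine (Finset.sum_le_sum fun x hx => ?_).trans (Finset.sum_le_sum_of_subset_of_nonneg
    (Finset.subset_univ B) fun x _ _ => mul_nonneg (tiltWeight_nonneg y x) (by positivity))
  have := tiltWeight_nonneg y x
  have := hB x hx
  gcongr

/-- Crude moment bound: `E tr A ^ (2 k) = O(N ^ (k + 1))`. -/
lemma traceMoment_le_const (hN : 0 < N) (k : ℕ) :
    traceMoment N (2 * k) ≤ (1 + (2 * k + 4 * k ^ 3)) ^ k * 4 ^ k * (N : ℝ) ^ (k + 1) := by
  have hN' : (1 : ℝ) ≤ N := by exact_mod_cast hN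
  refine (traceMoment_le_catalan k hN k le_rfl).trans ?_
  have h1 : (2 * k / N : ℝ) ≤ 2 * k := div_le_self (by positivity) hN'
  have h2 : (4 * k ^ 3 / N ^ 2 : ℝ) ≤ 4 * k ^ 3 := div_le_self (by positivity) (one_le_pow₀ hN')
  calc _ ≤ (N : ℝ) ^ (k + 1) * (1 + (2 * k + 4 * k ^ 3)) ^ k * 4 ^ k := by
        gcongr
        exact catalan_le_four_pow k
    _ = _ := by ring

lemma abs_norm_signMatrix_sub_le (x : Fin N × Fin N → ℤˣ) (t : ℝ) :
    |euclideanOpNorm (signMatrix x) - |t| * N| ≤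
      ‖signMatrix x - t • (Matrix.of fun _ _ => 1 : Matrix (Fin N) (Fin N) ℝ)‖ := by
  have h := abs_norm_sub_norm_le (signMatrix x)
    (t • (Matrix.of fun _ _ => 1 : Matrix (Fin N) (Fin N) ℝ))
  rw [norm_smul, norm_all_ones, Real.norm_eq_abs] at h
  exact h

end Symmetrization

section Density

lemma hasDerivAt_tanh (y : ℝ) : HasDerivAt Real.tanh (1 / Real.cosh y ^ 2) y := by
  have hc := (Real.cosh_pos y).ne'
  have h := (Real.hasDerivAt_sinh y).div (Real.hasDerivAt_cosh y) hc
  have h1 : Real.tanh = fun y => Real.sinh y / Real.cosh y :=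
    funext fun y => Real.tanh_eq_sinh_div_cosh y
  rw [h1]
  refine HasDerivAt.congr_deriv h ?_
  have h2 := Real.cosh_sq y
  rw [← sq, ← sq, h2, add_sub_cancel_left]

lemma strictConcaveOn_tanh : StrictConcaveOn ℝ (Set.Ici 0) Real.tanh := by
  refine StrictAntiOn.strictConcaveOn_of_deriv (convex_Ici 0)
    (fun y _ => (hasDerivAt_tanh y).continuousAt.continuousWithinAt) ?_
  rw [interior_Ici]
  intro a ha b hb hab
  rw [(hasDerivAt_tanh a).deriv, (hasDerivAt_tanh b).deriv]
  have h1 := Real.cosh_strictMonoOn (Set.mem_Ici.2 (le_of_lt ha)) (Set.mem_Ici.2 (le_of_lt hb)) hab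
  have h2 := Real.cosh_pos a
  gcongr

lemma tanh_mul_lt {a b : ℝ} (ha : 0 < a) (hab : a < b) : Real.tanh b * a < Real.tanh a * b := by
  have hb : 0 < b := ha.trans hab
  have h := strictConcaveOn_tanh.2 (Set.mem_Ici.2 le_rfl) (Set.mem_Ici.2 hb.le) hb.ne
    (sub_pos.2 ((div_lt_one hb).2 hab) : 0 < 1 - a / b) (by positivity : 0 < a / b) (by ring)
  simp only [smul_eq_mul, Real.tanh_zero, mul_zero, zero_add, div_mul_cancel₀ _ hb.ne'] at h
  rw [div_mul_eq_mul_div, div_lt_iff₀ hb] at h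
  linarith

lemma tanh_le_self {y : ℝ} (hy : 0 ≤ y) : Real.tanh y ≤ y := by
  have hmono : MonotoneOn (fun y => y - Real.tanh y) (Set.Ici 0) := by
    refine monotoneOn_of_deriv_nonneg (convex_Ici 0)
      (fun y _ => ((hasDerivAt_id y).sub (hasDerivAt_tanh y)).continuousAt.continuousWithinAt)
      (fun y _ => ((hasDerivAt_id y).sub (hasDerivAt_tanh y)).differentiableAt.differentiableWithinAt)
      fun y _ => ?_
    have h : HasDerivAt (fun y => y - Real.tanh y) (1 - 1 / Real.cosh y ^ 2) y :=
      (hasDerivAt_id y).sub (hasDerivAt_tanh y)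
    rw [h.deriv, sub_nonneg]
    exact div_le_one_of_le₀ (one_le_pow₀ (Real.one_le_cosh y)) (by positivity)
  have := hmono (Set.mem_Ici.2 le_rfl) (Set.mem_Ici.2 hy) hy
  simp only [Real.tanh_zero, sub_zero] at this
  linarith

lemma tanh_nonneg {y : ℝ} (hy : 0 ≤ y) : 0 ≤ Real.tanh y := by
  rw [Real.tanh_eq_sinh_div_cosh]
  exact div_nonneg (Real.sinh_nonneg_iff.2 hy) (Real.cosh_pos y).le

lemma abs_tanh (y : ℝ) : |Real.tanh y| = Real.tanh |y| := by
  rcases le_total 0 y with h | h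
  · rw [abs_of_nonneg h, abs_of_nonneg (tanh_nonneg h)]
  · rw [abs_of_nonpos h, Real.tanh_neg, abs_of_nonpos]
    have := tanh_nonneg (neg_nonneg.2 h)
    rw [Real.tanh_neg] at this
    linarith

lemma exists_tanh_eq_div {β : ℝ} (hβ : 1 < β) : ∃ y, 0 < y ∧ Real.tanh y = y / β := by
  have hβ0 : 0 < β := by linarith
  have h0 := (hasDerivAt_tanh 0).tendsto_slope_zero_right
  simp only [zero_add, Real.tanh_zero, sub_zero, Real.cosh_zero, one_pow, div_one,
    smul_eq_mul] at h0
  have h1 : β⁻¹ < 1 := inv_lt_one_of_one_lt₀ hβ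
  have hev : ∀ᶠ t in 𝓝[>] (0 : ℝ), t < β := by
    filter_upwards [Ioo_mem_nhdsGT hβ0] with t ht using ht.2
  have hev0 : ∀ᶠ t in 𝓝[>] (0 : ℝ), 0 < t := self_mem_nhdsWithin
  obtain ⟨a, ha, ha0', haβ⟩ := ((h0.eventually_const_lt h1).and (hev0.and hev)).exists
  have hcont : ContinuousOn (fun y => Real.tanh y - y / β) (Set.Icc a β) := fun y _ =>
    ((hasDerivAt_tanh y).continuousAt.sub (by fun_prop)).continuousWithinAt
  have hmem : (0 : ℝ) ∈ Set.Icc (Real.tanh β - β / β) (Real.tanh a - a / β) := by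
    constructor
    · rw [div_self hβ0.ne']
      linarith [Real.tanh_lt_one β]
    · rw [sub_nonneg, div_eq_inv_mul]
      have := mul_lt_mul_of_pos_right ha ha0'
      rw [mul_right_comm, inv_mul_cancel₀ ha0'.ne', one_mul] at this
      exact this.le
  obtain ⟨y, hy, hy0⟩ := intermediate_value_Icc' haβ.le hcont hmem
  exact ⟨y, ha0'.trans_le hy.1, by simpa [sub_eq_zero] using hy0⟩

lemma cwDensity_abs (β y : ℝ) : cwDensity β |y| = cwDensity β y := by
  rw [cwDensity, cwDensity, Real.cosh_abs, sq_abs]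

lemma hasDerivAt_cwDensity (β y : ℝ) :
    HasDerivAt (cwDensity β) (cwDensity β y * (Real.tanh y - y / β)) y := by
  have h1 : HasDerivAt (fun y : ℝ => -(y ^ 2 / (2 * β))) (-(y / β)) y := by
    have := (((hasDerivAt_id y).pow 2).div_const (2 * β)).neg
    refine this.congr_deriv ?_
    simp only [id_eq, mul_one]
    push_cast
    ring
  have h := (Real.hasDerivAt_cosh y).mul h1.exp
  refine HasDerivAt.congr_deriv h ?_
  rw [cwDensity, Real.tanh_eq_sinh_div_cosh]
  have := (Real.cosh_pos y).ne'
  field_simp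
  ring

lemma setIntegral_compl_cwDensity_pow_le {β : ℝ} (hβ : 0 < β) {K : Set ℝ} (hK : MeasurableSet K)
    {c : ℝ} (hc0 : 0 ≤ c) (hc : ∀ y ∉ K, cwDensity β y ≤ c) (M : ℕ) :
    ∫ y in Kᶜ, cwDensity β y ^ (M + 1) ≤ c ^ M * ∫ y, cwDensity β y := by
  have hint : Integrable (cwDensity β) := by
    simpa using integrable_cwDensity_pow hβ one_pos
  have hpos := cwDensity_pos β
  calc ∫ y in Kᶜ, cwDensity β y ^ (M + 1) ≤ ∫ y in Kᶜ, c ^ M * cwDensity β y := by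
        refine setIntegral_mono_on (integrable_cwDensity_pow hβ M.succ_pos).integrableOn
          (hint.const_mul _).integrableOn hK.compl fun y hy => ?_
        rw [pow_succ]
        exact mul_le_mul_of_nonneg_right (pow_le_pow_left₀ (hpos y).le (hc y hy) M) (hpos y).le
    _ ≤ ∫ y, c ^ M * cwDensity β y := setIntegral_le_integral (hint.const_mul _)
        (Eventually.of_forall fun y => mul_nonneg (pow_nonneg hc0 M) (hpos y).le)
    _ = _ := integral_const_mul _ _

/-! #### Low temperature -/

section LowTemperature

variable {β y₀ : ℝ}

lemma cwDensity_strictMonoOn (hy : Real.tanh y₀ = y₀ / β) :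
    StrictMonoOn (cwDensity β) (Set.Icc 0 y₀) := by
  refine strictMonoOn_of_deriv_pos (convex_Icc 0 y₀) (continuous_cwDensity β).continuousOn
    fun y h => ?_
  rw [interior_Icc] at h
  rw [(hasDerivAt_cwDensity β y).deriv]
  refine mul_pos (cwDensity_pos β y) ?_
  have hy0 : 0 < y₀ := h.1.trans h.2
  have h1 := tanh_mul_lt h.1 h.2
  rw [hy] at h1
  have h2 : y / β * y₀ < Real.tanh y * y₀ := by
    refine lt_of_eq_of_lt ?_ h1
    ring
  exact sub_pos.2 (lt_of_mul_lt_mul_right h2 hy0.le)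

lemma cwDensity_strictAntiOn (hy0 : 0 < y₀) (hy : Real.tanh y₀ = y₀ / β) :
    StrictAntiOn (cwDensity β) (Set.Ici y₀) := by
  refine strictAntiOn_of_deriv_neg (convex_Ici y₀) (continuous_cwDensity β).continuousOn
    fun y h => ?_
  rw [interior_Ici] at h
  rw [(hasDerivAt_cwDensity β y).deriv]
  refine mul_neg_of_pos_of_neg (cwDensity_pos β y) ?_
  have h1 := tanh_mul_lt hy0 h
  rw [hy] at h1
  have h2 : Real.tanh y * y₀ < y / β * y₀ := by
    refine lt_of_lt_of_eq h1 ?_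
    ring
  exact sub_neg.2 (lt_of_mul_lt_mul_right h2 hy0.le)

/-- For `β > 1` the mixing density concentrates exponentially fast near `± y₀`. -/
lemma exists_cwDensity_ratio_le (hβ : 0 < β) (hy0 : 0 < y₀) (hy : Real.tanh y₀ = y₀ / β)
    {δ : ℝ} (hδ : 0 < δ) :
    ∃ C ρ : ℝ, 0 ≤ C ∧ 0 < ρ ∧ ρ < 1 ∧ ∀ M : ℕ, 0 < M →
      (∫ y in {y | |(|y|) - y₀| ≤ δ}ᶜ, cwDensity β y ^ M) / ∫ y, cwDensity β y ^ M ≤ C * ρ ^ M := by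
  have hpos := cwDensity_pos β
  set δ' : ℝ := min δ (y₀ / 2) with hδ'
  have hδ'0 : 0 < δ' := lt_min hδ (by linarith)
  have hδ'y : δ' < y₀ := (min_le_right _ _).trans_lt (by linarith)
  set c : ℝ := max (cwDensity β (y₀ - δ')) (cwDensity β (y₀ + δ')) with hc
  have hc0 : 0 < c := lt_max_of_lt_left (hpos _)
  have hcy : c < cwDensity β y₀ := by
    refine max_lt ?_ ?_
    · exact cwDensity_strictMonoOn hy ⟨by linarith, by linarith⟩ ⟨hy0.le, le_rfl⟩ (by linarith)
    · exact cwDensity_strictAntiOn hy0 hy (Set.mem_Ici.2 le_rfl)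
        (Set.mem_Ici.2 (by linarith)) (by linarith)
  have hK : MeasurableSet {y : ℝ | |(|y|) - y₀| ≤ δ} :=
    (isClosed_le (by fun_prop) (by fun_prop)).measurableSet
  have hle : ∀ y ∉ {y : ℝ | |(|y|) - y₀| ≤ δ}, cwDensity β y ≤ c := by
    intro y hyK
    rw [← cwDensity_abs]
    have h1 : δ' < |(|y|) - y₀| := (min_le_left _ _).trans_lt (not_le.1 hyK)
    rcases lt_abs.1 h1 with h | h
    · refine le_trans ?_ (le_max_right _ _)
      exact (cwDensity_strictAntiOn hy0 hy).antitoneOn (Set.mem_Ici.2 (by linarith))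
        (Set.mem_Ici.2 (by linarith)) (by linarith)
    · refine le_trans ?_ (le_max_left _ _)
      exact (cwDensity_strictMonoOn hy).monotoneOn ⟨abs_nonneg y, by linarith⟩
        ⟨by linarith, by linarith⟩ (by linarith)
  obtain ⟨d, hcd, hdy⟩ := exists_between hcy
  have hd0 : 0 < d := hc0.trans hcd
  obtain ⟨r, hr, hball⟩ := Metric.mem_nhds_iff.1
    ((continuous_cwDensity β).continuousAt.eventually_const_lt hdy)
  set I : ℝ := ∫ y, cwDensity β y with hI
  have hI0 : 0 ≤ I := integral_nonneg fun y => (hpos y).le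
  refine ⟨I / (2 * r * c), c / d, by positivity, by positivity, (div_lt_one hd0).2 hcd,
    fun M hM => ?_⟩
  have hint := integrable_cwDensity_pow hβ hM
  have hlow : 2 * r * d ^ M ≤ ∫ y, cwDensity β y ^ M := by
    calc 2 * r * d ^ M = ∫ _ in Metric.ball y₀ r, d ^ M := by
          rw [setIntegral_const, Real.volume_real_ball hr.le, smul_eq_mul]
      _ ≤ ∫ y in Metric.ball y₀ r, cwDensity β y ^ M := by
          refine setIntegral_mono_on (by simp; right; finiteness) hint.integrableOn measurableSet_ball
            fun y hy => ?_
          exact pow_le_pow_left₀ hd0.le (le_of_lt (hball hy)) M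
      _ ≤ _ := setIntegral_le_integral hint
          (Eventually.of_forall fun y => pow_nonneg (hpos y).le M)
  have hup : ∫ y in {y | |(|y|) - y₀| ≤ δ}ᶜ, cwDensity β y ^ M ≤ c ^ M / c * I := by
    obtain ⟨M, rfl⟩ := Nat.exists_eq_succ_of_ne_zero hM.ne'
    refine (setIntegral_compl_cwDensity_pow_le hβ hK hc0.le hle M).trans (le_of_eq ?_)
    rw [Nat.succ_eq_add_one, pow_succ, mul_div_assoc, div_self hc0.ne', mul_one]
  calc _ ≤ c ^ M / c * I / (2 * r * d ^ M) := by gcongr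
    _ = _ := by
      rw [div_pow]
      field_simp

end LowTemperature

/-! #### Critical temperature -/

section Critical

lemma cwDensity_one_antitoneOn : AntitoneOn (cwDensity 1) (Set.Ici 0) := by
  refine antitoneOn_of_deriv_nonpos (convex_Ici 0) (continuous_cwDensity 1).continuousOn
    (fun y _ => (hasDerivAt_cwDensity 1 y).differentiableAt.differentiableWithinAt) fun y h => ?_
  rw [interior_Ici] at h
  rw [(hasDerivAt_cwDensity 1 y).deriv]
  have := tanh_le_self (le_of_lt h)
  refine mul_nonpos_of_nonneg_of_nonpos (cwDensity_pos 1 y).le ?_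
  rw [div_one]
  linarith

lemma cwDensity_one_le {r : ℝ} (h0 : 0 ≤ r) (h1 : r ≤ 1) :
    cwDensity 1 r ≤ Real.exp (-(r ^ 4 / 24)) := by
  have hcosh : Real.cosh r ≤ 1 + r ^ 2 / 2 + r ^ 4 / 24 + r ^ 6 * (7 / 4320) := by
    have e1 := Real.exp_bound (x := r) (abs_le.2 ⟨by linarith, h1⟩) (n := 6) (by norm_num)
    have e2 := Real.exp_bound (x := -r) (abs_le.2 ⟨by linarith, by linarith⟩) (n := 6) (by norm_num)
    rw [abs_neg] at e2
    rw [abs_of_nonneg h0] at e1 e2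
    simp only [Finset.sum_range_succ, Finset.sum_range_zero, Nat.factorial] at e1 e2
    norm_num at e1 e2
    have f1 := (abs_le.1 e1).2
    have f2 := (abs_le.1 e2).2
    rw [Real.cosh_eq]
    linarith
  have hu : 0 ≤ r ^ 2 / 2 - r ^ 4 / 24 := by nlinarith [pow_le_one₀ h0 h1 (n := 2), sq_nonneg r]
  have hexp := Real.quadratic_le_exp_of_nonneg hu
  have hle : Real.cosh r ≤ Real.exp (r ^ 2 / 2 - r ^ 4 / 24) := by
    refine hcosh.trans (le_trans ?_ hexp)
    have g1 : r ^ 2 ≤ 1 := pow_le_one₀ h0 h1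
    have g2 : r ^ 6 ≤ r ^ 4 := pow_le_pow_of_le_one h0 h1 (by norm_num)
    have g3 : 0 ≤ r ^ 8 := by positivity
    have g4 : 0 ≤ r ^ 4 := by positivity
    nlinarith
  rw [cwDensity]
  calc _ ≤ Real.exp (r ^ 2 / 2 - r ^ 4 / 24) * Real.exp (-(r ^ 2 / (2 * 1))) := by gcongr
    _ = _ := by
      rw [← Real.exp_add]
      congr 1
      ring

/-- For `β = 1` the mixing density concentrates on the scale `M ^ (-1/4)`. -/
lemma exists_cwDensity_one_ratio_le : ∃ C : ℝ, 0 ≤ C ∧ ∀ (M : ℕ) (r : ℝ), 0 < M → 0 ≤ r → r ≤ 1 →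
    (∫ y in {y | |y| ≤ r}ᶜ, cwDensity 1 y ^ M) / ∫ y, cwDensity 1 y ^ M ≤
      C * M * Real.exp (-(M * r ^ 4 / 24)) := by
  have hpos := cwDensity_pos 1
  set I : ℝ := ∫ y, cwDensity 1 y with hI
  have hI0 : 0 ≤ I := integral_nonneg fun y => (hpos y).le
  refine ⟨I * Real.exp 1, by positivity, fun M r hM hr0 hr1 => ?_⟩
  have hM1 : (1 : ℝ) ≤ M := by exact_mod_cast hM
  have hK : MeasurableSet {y : ℝ | |y| ≤ r} :=
    (isClosed_le (by fun_prop) (by fun_prop)).measurableSet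
  have hle : ∀ y ∉ {y : ℝ | |y| ≤ r}, cwDensity 1 y ≤ Real.exp (-(r ^ 4 / 24)) := by
    intro y hy
    rw [← cwDensity_abs]
    refine le_trans ?_ (cwDensity_one_le hr0 hr1)
    exact cwDensity_one_antitoneOn (Set.mem_Ici.2 hr0) (Set.mem_Ici.2 (abs_nonneg y))
      (le_of_lt (not_le.1 hy))
  have hint := integrable_cwDensity_pow one_pos hM
  have hlow : (M : ℝ)⁻¹ ≤ ∫ y, cwDensity 1 y ^ M := by
    calc (M : ℝ)⁻¹ ≤ √(Real.pi / (M / 2)) := by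
          refine Real.le_sqrt_of_sq_le ?_
          have hpi := Real.pi_gt_three
          rw [inv_pow, ← one_div, div_le_div_iff₀ (by positivity) (by positivity)]
          nlinarith
      _ = ∫ y, Real.exp (-(M / 2) * y ^ 2) := (integral_gaussian _).symm
      _ ≤ _ := by
          refine integral_mono (integrable_exp_neg_mul_sq (by positivity)) hint fun y => ?_
          simp only [cwDensity]
          calc Real.exp (-(M / 2) * y ^ 2) = Real.exp (-(y ^ 2 / (2 * 1))) ^ M := by
                rw [← Real.exp_nat_mul]
                congr 1
                ring
            _ ≤ _ := by
                gcongr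
                exact le_mul_of_one_le_left (Real.exp_pos _).le (Real.one_le_cosh y)
  have hup : ∫ y in {y | |y| ≤ r}ᶜ, cwDensity 1 y ^ M ≤
      Real.exp 1 * Real.exp (-(M * r ^ 4 / 24)) * I := by
    obtain ⟨M, rfl⟩ := Nat.exists_eq_succ_of_ne_zero hM.ne'
    refine (setIntegral_compl_cwDensity_pow_le one_pos hK (Real.exp_pos _).le hle M).trans ?_
    rw [← Real.exp_nat_mul, ← Real.exp_add]
    refine mul_le_mul_of_nonneg_right (Real.exp_le_exp.2 ?_) hI0
    have : r ^ 4 ≤ 1 := pow_le_one₀ hr0 hr1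
    push_cast
    nlinarith
  calc _ ≤ Real.exp 1 * Real.exp (-(M * r ^ 4 / 24)) * I / (M : ℝ)⁻¹ := by gcongr
    _ = _ := by
      rw [div_inv_eq_mul]
      ring

end Critical

end Density

section MainTheorem

open scoped Matrix.Norms.L2Operator

lemma ae_eventually_notMem_of_le_div_sq {Ω : Type*} [MeasurableSpace Ω] {P : Measure Ω}
    {s : ℕ → Set Ω} {C : ℝ} (hC : 0 ≤ C)
    (h : ∀ᶠ N : ℕ in atTop, P (s N) ≤ ENNReal.ofReal (C / N ^ 2)) :
    ∀ᵐ ω ∂P, ∀ᶠ N in atTop, ω ∉ s N := by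
  obtain ⟨n₀, hn₀⟩ := eventually_atTop.1 h
  have hsum : Summable fun N : ℕ => C / ((N + n₀ : ℕ) : ℝ) ^ 2 :=
    (summable_nat_add_iff (f := fun N : ℕ => C / (N : ℝ) ^ 2) n₀).2
      ((Real.summable_nat_pow_inv.2 one_lt_two).mul_left C)
  have hfin : ∑' N, P (s (N + n₀)) ≠ ⊤ := by
    refine ne_top_of_le_ne_top ?_ (ENNReal.tsum_le_tsum fun N => hn₀ (N + n₀) (Nat.le_add_left _ _))
    rw [← ENNReal.ofReal_tsum_of_nonneg (fun N => by positivity) hsum]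
    exact ENNReal.ofReal_ne_top
  filter_upwards [ae_eventually_notMem hfin] with ω hω
  obtain ⟨m, hm⟩ := eventually_atTop.1 hω
  refine eventually_atTop.2 ⟨m + n₀, fun N hN => ?_⟩
  have := hm (N - n₀) (by omega)
  rwa [Nat.sub_add_cancel (by omega)] at this

variable {Ω : Type*} [MeasurableSpace Ω] {P : Measure Ω} [IsProbabilityMeasure P] {β : ℝ}
  {X : (N : ℕ) → Ω → Matrix (Fin N) (Fin N) ℝ}

lemma IsFullCurieWeissEnsemble.measure_le (hX : IsFullCurieWeissEnsemble P β X) {N : ℕ}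
    (S : Set (Matrix (Fin N) (Fin N) ℝ)) (B : Finset (Fin N × Fin N → ℤˣ))
    (hB : ∀ x, signMatrix x ∈ S → x ∈ B) :
    P {ω | X N ω ∈ S} ≤ ENNReal.ofReal (cwProb β B) := by
  obtain ⟨Y, hY, hXY⟩ := hX N
  have h : ∀ ω, X N ω = symmMatrix fun e => Y e ω := by
    intro ω
    ext i j
    rw [hXY, symmMatrix_apply, symmKey]
    split_ifs <;> rfl
  simp_rw [h]
  exact hY.measure_le (symmMatrix ⁻¹' S) B hB

/-- Events with Curie-Weiss probability `O(N⁻²)` almost surely occur only finitely often. -/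
lemma IsFullCurieWeissEnsemble.ae_eventually (hX : IsFullCurieWeissEnsemble P β X)
    (S : (N : ℕ) → Set (Matrix (Fin N) (Fin N) ℝ)) (B : (N : ℕ) → Finset (Fin N × Fin N → ℤˣ))
    (hB : ∀ N x, signMatrix x ∈ S N → x ∈ B N) {C : ℝ} (hC : 0 ≤ C)
    (h : ∀ᶠ N : ℕ in atTop, cwProb β (B N) ≤ C / N ^ 2) :
    ∀ᵐ ω ∂P, ∀ᶠ N in atTop, X N ω ∉ S N := by
  refine ae_eventually_notMem_of_le_div_sq (s := fun N => {ω | X N ω ∈ S N}) hC ?_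
  filter_upwards [h] with N hN
  exact (hX.measure_le (S N) (B N) (hB N)).trans (ENNReal.ofReal_le_ofReal hN)

lemma euclideanOpNorm_smul {N : ℕ} {c : ℝ} (hc : 0 ≤ c) (A : Matrix (Fin N) (Fin N) ℝ) :
    euclideanOpNorm (c • A) = c * euclideanOpNorm A := by
  rw [euclideanOpNorm_eq_norm, norm_smul, Real.norm_eq_abs, abs_of_nonneg hc]
  rfl

lemma card_index (N : ℕ) : Fintype.card (Fin N × Fin N) = N ^ 2 := by simp [sq]

/-! #### High temperature -/

lemma ae_eventually_norm_high_temperature (hβ0 : 0 ≤ β) (hβ1 : β < 1)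
    (hX : IsFullCurieWeissEnsemble P β X) {ε : ℝ} (hε : 0 < ε) (hε2 : ε ≤ 2) :
    ∀ᵐ ω ∂P, ∀ᶠ N : ℕ in atTop,
      X N ω ∉ {A | (2 + ε) * √N ≤ euclideanOpNorm A ∨ euclideanOpNorm A ≤ (2 - ε) * √N} := by
  obtain ⟨n, C, hC⟩ := exists_cwProb_le hβ0 hβ1
  refine hX.ae_eventually _
    (fun N => normGE N ((2 + ε) * √N) ∪ normLE N ((2 - ε) * √N)) (fun N x hx => ?_)
    (C := 2 + |C|) (by positivity) ?_
  · rw [Finset.mem_union, mem_normGE, mem_normLE]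
    exact hx
  · filter_upwards [eventually_signProb_normGE hε (2 * n + 2),
      eventually_signProb_normLE (sub_nonneg.2 hε2) (by linarith : 2 - ε < 2) (2 * n + 2),
      eventually_gt_atTop 0] with N h1 h2 hN
    have hN' : (0 : ℝ) < N := by exact_mod_cast hN
    have h3 := hC (Fin N × Fin N) (by rw [card_index]; positivity)
      (normGE N ((2 + ε) * √N) ∪ normLE N ((2 - ε) * √N)) ((N : ℝ) ^ 2) (by positivity)
    refine h3.trans ?_
    rw [add_div]
    refine add_le_add ?_ ?_
    · have h4 := signProb_union_le (normGE N ((2 + ε) * √N)) (normLE N ((2 - ε) * √N))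
      rw [le_div_iff₀ (by positivity)]
      have h5 := mul_le_mul_of_nonneg_right h4 (by positivity : (0 : ℝ) ≤ (N : ℝ) ^ (2 * n + 2))
      calc _ = signProb (normGE N ((2 + ε) * √N) ∪ normLE N ((2 - ε) * √N)) *
            (N : ℝ) ^ (2 * n + 2) := by ring
        _ ≤ 2 := by linarith
    · gcongr
      exact le_abs_self C

lemma ae_tendsto_norm_high_temperature (hβ0 : 0 ≤ β) (hβ1 : β < 1)
    (hX : IsFullCurieWeissEnsemble P β X) : ∀ᵐ ω ∂P,
      Tendsto (fun N : ℕ => euclideanOpNorm ((1 / Real.sqrt (N : ℝ)) • X N ω)) atTop (𝓝 2) := by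
  have h : ∀ᵐ ω ∂P, ∀ j : ℕ, ∀ᶠ N : ℕ in atTop,
      X N ω ∉ {A | (2 + 1 / ((j : ℝ) + 1)) * √N ≤ euclideanOpNorm A ∨
        euclideanOpNorm A ≤ (2 - 1 / ((j : ℝ) + 1)) * √N} := by
    rw [ae_all_iff]
    intro j
    have h1 : 1 / ((j : ℝ) + 1) ≤ 1 := div_le_one_of_le₀ (by linarith [j.cast_nonneg (α := ℝ)])
      (by positivity)
    exact ae_eventually_norm_high_temperature hβ0 hβ1 hX (by positivity) (by linarith)
  filter_upwards [h] with ω hω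
  rw [Metric.tendsto_atTop']
  intro ε hε
  obtain ⟨j, hj⟩ := exists_nat_one_div_lt hε
  obtain ⟨n, hn⟩ := eventually_atTop.1 (hω j)
  refine ⟨n, fun N hN => ?_⟩
  have hs : (0 : ℝ) < √N := Real.sqrt_pos.2 (by exact_mod_cast (by omega : 0 < N))
  have h1 := hn N hN.le
  simp only [not_or, not_le] at h1
  rw [euclideanOpNorm_smul (by positivity), Real.dist_eq, one_div_mul_eq_div, abs_sub_lt_iff]
  have h2 := (div_lt_iff₀ hs).2 h1.1
  have h3 := (lt_div_iff₀ hs).2 h1.2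
  constructor <;> linarith

/-! #### Low temperature -/

lemma abs_tanh_sub_tanh_le (a b : ℝ) : |Real.tanh a - Real.tanh b| ≤ |a - b| := by
  have h : ∀ y ∈ (Set.univ : Set ℝ), ‖deriv Real.tanh y‖ ≤ 1 := by
    intro y _
    rw [(hasDerivAt_tanh y).deriv, Real.norm_eq_abs, abs_of_nonneg (by positivity)]
    exact div_le_one_of_le₀ (one_le_pow₀ (Real.one_le_cosh y)) (by positivity)
  have := convex_univ.norm_image_sub_le_of_norm_deriv_le
    (fun y _ => (hasDerivAt_tanh y).differentiableAt) h (Set.mem_univ b) (Set.mem_univ a)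
  simpa [Real.norm_eq_abs] using this

/-- The configurations for which the norm of the matrix differs from `m N` by at least `δ N`. -/
def normFar (N : ℕ) (m δ : ℝ) : Finset (Fin N × Fin N → ℤˣ) :=
  open Classical in Finset.univ.filter fun x => δ * N ≤ |euclideanOpNorm (signMatrix x) - m * N|

lemma exists_cwProb_normFar_le {y₀ : ℝ} (hβ : 0 < β) (hy0 : 0 < y₀) (hy : Real.tanh y₀ = y₀ / β)
    {δ : ℝ} (hδ : 0 < δ) :
    ∃ C : ℝ, 0 ≤ C ∧ ∀ᶠ N : ℕ in atTop, cwProb β (normFar N (Real.tanh y₀) δ) ≤ C / N ^ 2 := by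
  obtain ⟨C, ρ, hC, hρ0, hρ1, hratio⟩ := exists_cwDensity_ratio_le hβ hy0 hy (half_pos hδ)
  obtain ⟨T, hT0, hT⟩ : ∃ T : ℝ, 0 ≤ T ∧ ∀ N : ℕ, 0 < N →
      traceMoment N (2 * 3) ≤ T * (N : ℝ) ^ (3 + 1) :=
    ⟨_, by positivity, fun N hN => traceMoment_le_const hN 3⟩
  refine ⟨4 ^ 3 * T / (δ / 2) ^ 6 + C, by positivity, ?_⟩
  have hlim := (tendsto_self_mul_const_pow_of_lt_one hρ0.le hρ1).comp
    (tendsto_pow_atTop (α := ℕ) two_ne_zero)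
  filter_upwards [eventually_gt_atTop 0, hlim.eventually_le_const one_pos] with N hN hlimN
  have hN' : (0 : ℝ) < N := by exact_mod_cast hN
  have hcard : 0 < Fintype.card (Fin N × Fin N) := by rw [card_index]; positivity
  have hK : MeasurableSet {y : ℝ | |(|y|) - y₀| ≤ δ / 2} :=
    (isClosed_le (by fun_prop) (by fun_prop)).measurableSet
  have h1 := cwProb_le_of_tiltProb_le hβ hcard (normFar N (Real.tanh y₀) δ) hK
    (δ := 4 ^ 3 * T / (δ / 2) ^ 6 / N ^ 2) (by positivity) (fun y hyK => by
      have h2 := tiltProb_mul_pow_le hN y 3 (s := δ / 2 * N) (by positivity)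
        (normFar N (Real.tanh y₀) δ) (fun x hx => by
          refine le_trans ?_ (abs_norm_signMatrix_sub_le x _)
          have hx' : δ * N ≤ |euclideanOpNorm (signMatrix x) - Real.tanh y₀ * N| := by
            simpa [normFar] using hx
          have h3 : |(|Real.tanh y|) - Real.tanh y₀| ≤ δ / 2 := by
            rw [abs_tanh]
            exact (abs_tanh_sub_tanh_le _ _).trans hyK
          have h4 : |(|Real.tanh y|) * N - Real.tanh y₀ * N| ≤ δ / 2 * N := by
            rw [← sub_mul, abs_mul, abs_of_pos hN']
            gcongr
          have h5 := abs_sub_le (euclideanOpNorm (signMatrix x)) (|Real.tanh y| * N)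
            (Real.tanh y₀ * N)
          linarith)
      have h6 := h2.trans (mul_le_mul_of_nonneg_left (hT N hN) (by positivity))
      rw [← le_div_iff₀ (by positivity)] at h6
      refine h6.trans (le_of_eq ?_)
      field_simp
      ring)
  refine h1.trans ?_
  rw [add_div]
  refine add_le_add_right ?_ _
  rw [card_index]
  refine (hratio (N ^ 2) (by positivity)).trans ?_
  rw [div_eq_mul_inv]
  refine mul_le_mul_of_nonneg_left ?_ hC
  rw [← one_div, le_div_iff₀ (by positivity), mul_comm]
  exact_mod_cast hlimN

lemma ae_tendsto_norm_low_temperature {y₀ : ℝ} (hβ : 0 < β) (hy0 : 0 < y₀)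
    (hy : Real.tanh y₀ = y₀ / β) (hX : IsFullCurieWeissEnsemble P β X) : ∀ᵐ ω ∂P,
      Tendsto (fun N : ℕ => euclideanOpNorm ((1 / (N : ℝ)) • X N ω)) atTop
        (𝓝 (Real.tanh y₀)) := by
  have h : ∀ᵐ ω ∂P, ∀ j : ℕ, ∀ᶠ N : ℕ in atTop,
      X N ω ∉ {A | 1 / ((j : ℝ) + 1) * N ≤ |euclideanOpNorm A - Real.tanh y₀ * N|} := by
    rw [ae_all_iff]
    intro j
    obtain ⟨C, hC, hev⟩ := exists_cwProb_normFar_le hβ hy0 hy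
      (by positivity : 0 < 1 / ((j : ℝ) + 1))
    exact hX.ae_eventually _ _ (fun N x hx => by simpa [normFar] using hx) hC hev
  filter_upwards [h] with ω hω
  rw [Metric.tendsto_atTop']
  intro ε hε
  obtain ⟨j, hj⟩ := exists_nat_one_div_lt hε
  obtain ⟨n, hn⟩ := eventually_atTop.1 (hω j)
  refine ⟨n, fun N hN => ?_⟩
  have hN' : (0 : ℝ) < N := by exact_mod_cast (by omega : 0 < N)
  have h1 := hn N hN.le
  simp only [not_le] at h1
  rw [euclideanOpNorm_smul (by positivity), Real.dist_eq, one_div_mul_eq_div]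
  have h2 : euclideanOpNorm (X N ω) / N - Real.tanh y₀ =
      (euclideanOpNorm (X N ω) - Real.tanh y₀ * N) / N := by field_simp
  rw [h2, abs_div, abs_of_pos hN', div_lt_iff₀ hN']
  refine h1.trans ?_
  gcongr

/-! #### Critical temperature -/

lemma exists_cwProb_one_normGE_le {δ : ℝ} (hδ : 0 < δ) (hδ2 : δ ≤ 1 / 2) :
    ∃ C : ℝ, 0 ≤ C ∧ ∀ᶠ N : ℕ in atTop,
      cwProb 1 (normGE N (2 * (N : ℝ) ^ (1 / 2 + δ))) ≤ C / N ^ 2 := by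
  obtain ⟨C, hC, hratio⟩ := exists_cwDensity_one_ratio_le
  obtain ⟨k, hk⟩ := exists_nat_ge (3 / (2 * δ))
  rw [div_le_iff₀ (by positivity)] at hk
  obtain ⟨T, hT0, hT⟩ : ∃ T : ℝ, 0 ≤ T ∧ ∀ N : ℕ, 0 < N →
      traceMoment N (2 * k) ≤ T * (N : ℝ) ^ (k + 1) :=
    ⟨_, by positivity, fun N hN => traceMoment_le_const hN k⟩
  refine ⟨4 ^ k * T + C, by positivity, ?_⟩
  have hlim := (tendsto_rpow_mul_exp_neg_mul_atTop_nhds_zero (1 / δ) (1 / 24) (by norm_num)).comp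
    ((tendsto_rpow_atTop (by positivity : 0 < 4 * δ)).comp tendsto_natCast_atTop_atTop)
  filter_upwards [eventually_gt_atTop 0, hlim.eventually_le_const one_pos] with N hN hlimN
  have hN' : (0 : ℝ) < N := by exact_mod_cast hN
  have hN1 : (1 : ℝ) ≤ N := by exact_mod_cast hN
  have hcard : 0 < Fintype.card (Fin N × Fin N) := by rw [card_index]; positivity
  set r : ℝ := (N : ℝ) ^ (-(1 / 2) + δ) with hr
  have hr0 : 0 ≤ r := by positivity
  have hr1 : r ≤ 1 := Real.rpow_le_one_of_one_le_of_nonpos hN1 (by linarith)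
  have hrN : r * N = (N : ℝ) ^ (1 / 2 + δ) := by
    rw [hr, ← Real.rpow_add_one hN'.ne']
    congr 1
    ring
  have hr4 : (N : ℝ) ^ 2 * r ^ 4 = (N : ℝ) ^ (4 * δ) := by
    rw [hr, ← Real.rpow_natCast, ← Real.rpow_natCast, ← Real.rpow_mul hN'.le, ← Real.rpow_add hN']
    congr 1
    push_cast
    ring
  have hK : MeasurableSet {y : ℝ | |y| ≤ r} :=
    (isClosed_le (by fun_prop) (by fun_prop)).measurableSet
  have hpow : (N : ℝ) ^ (k + 3) ≤ ((N : ℝ) ^ (1 / 2 + δ)) ^ (2 * k) := by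
    rw [← Real.rpow_natCast, ← Real.rpow_natCast ((N : ℝ) ^ (1 / 2 + δ)), ← Real.rpow_mul hN'.le]
    refine Real.rpow_le_rpow_of_exponent_le hN1 ?_
    push_cast
    nlinarith
  have h1 := cwProb_le_of_tiltProb_le one_pos hcard (normGE N (2 * (N : ℝ) ^ (1 / 2 + δ))) hK
    (δ := 4 ^ k * T / N ^ 2) (by positivity) (fun y hyK => by
      have h2 := tiltProb_mul_pow_le hN y k (s := (N : ℝ) ^ (1 / 2 + δ)) (by positivity)
        (normGE N (2 * (N : ℝ) ^ (1 / 2 + δ))) (fun x hx => by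
          refine le_trans ?_ (abs_norm_signMatrix_sub_le x _)
          rw [mem_normGE] at hx
          have h3 : |Real.tanh y| * N ≤ (N : ℝ) ^ (1 / 2 + δ) := by
            rw [← hrN, abs_tanh]
            gcongr
            exact (tanh_le_self (abs_nonneg y)).trans hyK
          refine le_trans ?_ (le_abs_self _)
          linarith)
      have h6 := h2.trans (mul_le_mul_of_nonneg_left (hT N hN) (by positivity))
      have h7 := (mul_le_mul_of_nonneg_left hpow (tiltProb_nonneg y _)).trans h6
      rw [← le_div_iff₀ (by positivity)] at h7
      refine h7.trans (le_of_eq ?_)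
      field_simp
      ring)
  refine h1.trans ?_
  rw [add_div]
  refine add_le_add_right ?_ _
  rw [card_index]
  refine (hratio (N ^ 2) r (by positivity) hr0 hr1).trans ?_
  push_cast
  rw [hr4, mul_assoc, ← mul_one_div C]
  refine mul_le_mul_of_nonneg_left ?_ hC
  rw [le_div_iff₀ (by positivity)]
  refine le_trans (le_of_eq ?_) hlimN
  simp only [Function.comp_apply]
  rw [← Real.rpow_mul hN'.le, show 4 * δ * (1 / δ) = ((4 : ℕ) : ℝ) by field_simp; norm_num,
    Real.rpow_natCast, show -(1 / 24) * (N : ℝ) ^ (4 * δ) = -((N : ℝ) ^ (4 * δ) / 24) by ring]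
  ring

lemma ae_tendsto_norm_critical (hX : IsFullCurieWeissEnsemble P 1 X) :
    ∀ᵐ ω ∂P, ∀ γ : ℝ, 1 / 2 < γ →
      Tendsto (fun N : ℕ => euclideanOpNorm ((1 / (N : ℝ) ^ γ) • X N ω)) atTop (𝓝 0) := by
  have h : ∀ᵐ ω ∂P, ∀ j : ℕ, ∀ᶠ N : ℕ in atTop,
      X N ω ∉ {A | 2 * (N : ℝ) ^ (1 / 2 + 1 / 2 * (1 / ((j : ℝ) + 1))) ≤ euclideanOpNorm A} := by
    rw [ae_all_iff]
    intro j
    have h1 : 1 / ((j : ℝ) + 1) ≤ 1 := div_le_one_of_le₀ (by linarith [j.cast_nonneg (α := ℝ)])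
      (by positivity)
    obtain ⟨C, hC, hev⟩ := exists_cwProb_one_normGE_le
      (by positivity : 0 < 1 / 2 * (1 / ((j : ℝ) + 1))) (by linarith)
    exact hX.ae_eventually _ _ (fun N x hx => mem_normGE.2 hx) hC hev
  filter_upwards [h] with ω hω γ hγ
  obtain ⟨j, hj⟩ := exists_nat_one_div_lt (sub_pos.2 hγ)
  set δ : ℝ := 1 / 2 * (1 / ((j : ℝ) + 1)) with hδ
  have hδγ : 1 / 2 + δ < γ := by
    have : 0 < 1 / ((j : ℝ) + 1) := by positivity
    rw [hδ]
    linarith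
  have hlim : Tendsto (fun N : ℕ => 2 * (N : ℝ) ^ (-(γ - (1 / 2 + δ)))) atTop (𝓝 0) := by
    have := ((tendsto_rpow_neg_atTop (sub_pos.2 hδγ)).comp tendsto_natCast_atTop_atTop).const_mul 2
    rw [mul_zero] at this
    exact this
  refine tendsto_of_tendsto_of_tendsto_of_le_of_le' tendsto_const_nhds hlim
    (Eventually.of_forall fun N => norm_nonneg _) ?_
  filter_upwards [hω j, eventually_gt_atTop 0] with N h1 hN
  have hN' : (0 : ℝ) < N := by exact_mod_cast hN
  simp only [not_le] at h1
  rw [euclideanOpNorm_smul (by positivity), one_div_mul_eq_div, div_le_iff₀ (by positivity),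
    mul_assoc, ← Real.rpow_add hN', show -(γ - (1 / 2 + δ)) + γ = 1 / 2 + δ by ring]
  exact h1.le

end MainTheorem
end

theorem theorem7p8 {Ω : Type*} [MeasurableSpace Ω] (P : Measure Ω) [IsProbabilityMeasure P]
    (β : ℝ) (hβ : 0 ≤ β) (X : (N : ℕ) → Ω → Matrix (Fin N) (Fin N) ℝ)
    (hX : IsFullCurieWeissEnsemble P β X) :
    (β < 1 → ∀ᵐ ω ∂P,
      Tendsto (fun N : ℕ => euclideanOpNorm ((1 / Real.sqrt (N : ℝ)) • X N ω)) atTop (𝓝 2)) ∧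
    (β = 1 → ∀ᵐ ω ∂P, ∀ γ : ℝ, 1 / 2 < γ →
      Tendsto (fun N : ℕ => euclideanOpNorm ((1 / (N : ℝ) ^ γ) • X N ω)) atTop (𝓝 0)) ∧
    (1 < β → ∃ m : ℝ, IsCurieWeissMagnetization β m ∧
      (∀ m' : ℝ, IsCurieWeissMagnetization β m' → m' = m) ∧
      ∀ᵐ ω ∂P,
        Tendsto (fun N : ℕ => euclideanOpNorm ((1 / (N : ℝ)) • X N ω)) atTop (𝓝 m)) := by
  refine ⟨fun h => ae_tendsto_norm_high_temperature hβ h hX, fun h => ?_, fun h => ?_⟩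
  · subst h
    exact ae_tendsto_norm_critical hX
  · have hβ0 : 0 < β := by linarith
    obtain ⟨y, hy0, hy⟩ := exists_tanh_eq_div h
    have hm : 0 < y / β := by positivity
    refine ⟨y / β, ⟨hm, by rw [mul_div_cancel₀ _ hβ0.ne', hy]⟩, fun m' hm' => ?_, ?_⟩
    · obtain ⟨h0, h1⟩ := hm'
      have hlt : ∀ a b : ℝ, 0 < a → Real.tanh (β * a) = a → Real.tanh (β * b) = b → ¬ a < b := by
        intro a b ha hta htb hab
        have := tanh_mul_lt (mul_pos hβ0 ha) (mul_lt_mul_of_pos_left hab hβ0)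
        rw [hta, htb] at this
        nlinarith
      have hy' : Real.tanh (β * (y / β)) = y / β := by rw [mul_div_cancel₀ _ hβ0.ne', hy]
      exact le_antisymm (not_lt.1 (hlt _ _ hm hy' h1)) (not_lt.1 (hlt _ _ h0 h1 hy'))
    · rw [← hy]
      exact ae_tendsto_norm_low_temperature hβ0 hy0 hy hX
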